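/- Let $V$ be a smooth ($C^\infty$) unit vector field on hyperbolic space $\mathbb{H}^3$ (constant curvature $-1$), all of whose integral curves are geodesics, i.e. a smooth foliation of $\mathbb{H}^3$ by oriented geodesics. Let $\mathcal{L}$ be the four-dimensional manifold of all complete oriented geodesics of $\mathbb{H}^3$, and let $\mathcal{M}\subset\mathcal{L}$ be the submanifold consisting of the leaves of the foliation. For a unit speed geodesic $\gamma$, let $\mathcal{J}_\gamma$ be the space of Jacobi fields along $\gamma$ orthogonal to $\dot\gamma$, and let $T_\gamma:\mathcal{J}_\gamma\to T_{[\gamma]}\mathcal{L}$ be the canonical isomorphism $T_\gamma(J)=\frac{d}{dt}\big|_0[\gamma_t]$, where $\gamma_t$ is any variation of $\gamma$ by unit speed geodesics associated with $J$. The two canonical neutral metrics $g_\times$ and $g_K$ on $\mathcal{L}$ have the square norms $$\|T_\gamma(J)\|_\times=\langle\dot\gamma\times J,J'\rangle,\qquad \|T_\gamma(J)\|_K=|J|^2-|J'|^2 ,$$ where the right-hand sides are constant along $\gamma$ and $\times$ is the cross product given by a fixed orientation of $\mathbb{H}^3$. Let $\mathbb{H}^3(\infty)$ be the sphere at infinity,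 i.e. the set of classes of asymptotic unit speed geodesics with its canonical differentiable structure, and let $\varphi^{\pm}:\mathcal{L}\to\mathbb{H}^3(\infty)$, $\varphi^\pm([\gamma])=\gamma(\pm\infty)$, be the forward and backward Gauss maps. Then: (a) Both maps $\varphi^{+},\varphi^{-}:\mathcal{M}\to\mathbb{H}^3(\infty)$ are local diffeomorphisms (the foliation is semi-nondegenerate) if and only if $\mathcal{M}$ is semidefinite, that is, $\|X\|_K>0$ for every nonzero $X\in T\mathcal{M}$ with $\|X\|_\times=0$. (b) The only eigenvectors of $\nabla V$ (i.e. of the endomorphisms $u\mapsto\nabla_uV$ of $T_p\mathbb{H}^3$, $p\in\mathbb{H}^3$) are those in $\mathbb{R}V$ (the foliation is nondegenerate) if and only if $g_\times$ induces on $\mathcal{M}$ a definite metric, that is, either $\|X\|_\times>0$ for all nonzero $X\in T\mathcal{M}$ or $\|X\|_\times<0$ for all nonzero $X\in T\mathcal{M}$. -/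

import Mathlib

open scoped ContDiff

noncomputable section

namespace HypFoliation

/-! ## The hyperboloid model of hyperbolic three-space -/

/-- The ambient vector space of Minkowski space. -/
abbrev R4 : Type := Fin 4 → ℝ

/-- The Lorentz form of signature `(-,+,+,+)`. -/
def mink (x y : R4) : ℝ := -(x 0 * y 0) + x 1 * y 1 + x 2 * y 2 + x 3 * y 3

/-- Hyperbolic space `ℍ³`: the upper sheet of the hyperboloid `⟨x, x⟩ = -1`.  Its tangent space at
`p` is `{u | mink p u = 0}`, and the Riemannian metric is the restriction of `mink`. -/
def H3 : Set R4 := {p | mink p p = -1 ∧ 0 < p 0}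

/-- The hyperbolic distance. -/
def hdist (p q : R4) : ℝ := Real.arcosh (-mink p q)

/-- The orthogonal projection of Minkowski space onto the tangent space `T_p ℍ³`. -/
def tproj (p w : R4) : R4 := w + mink p w • p

/-- The covariant derivative `DW/ds` at `s` of a vector field `W` along a curve `c` in `ℍ³`: the
tangential part of the ordinary derivative. -/
def covDerivAlong (c W : ℝ → R4) (s : ℝ) : R4 := tproj (c s) (deriv W s)

/-- The radial projection onto the hyperboloid; it is defined (and smooth) on the open future cone
and it fixes `ℍ³` pointwise. -/
def radialProj (x : R4) : R4 := (Real.sqrt (-mink x x))⁻¹ • x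

/-- The Levi-Civita covariant derivative `∇_u V` at `p` of a vector field on `ℍ³`: the tangential
part of the ordinary derivative of `V` in the direction `u`.  Since `V` matters only on `ℍ³`,
it is first extended to the future cone, constantly along rays. -/
def covDeriv (V : R4 → R4) (p u : R4) : R4 :=
  tproj p (fderiv ℝ (fun x => V (radialProj x)) p u)

/-- The curvature tensor `R(X, Y)Z` of constant sectional curvature `-1`. -/
def curv (X Y Z : R4) : R4 := -(mink Y Z • X - mink X Z • Y)

/-- The cross product of `T_p ℍ³` for the standard orientation: the vector with
`⟨cross p u v, w⟩ = det (p, u, v, w)` for all `w`. -/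
def cross (p u v : R4) : R4 := fun i =>
  (if i = 0 then -1 else 1) * Matrix.det (Matrix.of ![p, u, v, Pi.single i 1])

/-- A unit tangent vector `dir` of `ℍ³` at the foot point `base`. -/
@[ext]
structure UnitTangent where
  base : R4
  dir : R4
  base_mem : base ∈ H3
  orth : mink base dir = 0
  unit : mink dir dir = 1

namespace UnitTangent

/-- The unit speed geodesic `γ_u` with initial velocity `u`. -/
def geod (u : UnitTangent) (s : ℝ) : R4 := Real.cosh s • u.base + Real.sinh s • u.dir

/-- The velocity of the geodesic `γ_u`. -/
def vel (u : UnitTangent) (s : ℝ) : R4 := Real.sinh s • u.base + Real.cosh s • u.dir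

theorem abs_dir_lt (u : UnitTangent) : |u.dir 0| < u.base 0 := by
  obtain ⟨p, v, ⟨hp, hp0⟩, hpv, hv⟩ := u
  simp only [mink] at hp hpv hv ⊢
  apply abs_lt_of_sq_lt_sq _ hp0.le
  have h1 : (p 1 * v 1 + p 2 * v 2 + p 3 * v 3) ^ 2
      ≤ (p 1 ^ 2 + p 2 ^ 2 + p 3 ^ 2) * (v 1 ^ 2 + v 2 ^ 2 + v 3 ^ 2) := by
    nlinarith [sq_nonneg (p 1 * v 2 - p 2 * v 1), sq_nonneg (p 1 * v 3 - p 3 * v 1),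
      sq_nonneg (p 2 * v 3 - p 3 * v 2)]
  have h2 : p 1 * v 1 + p 2 * v 2 + p 3 * v 3 = p 0 * v 0 := by linarith
  have h3 : p 1 ^ 2 + p 2 ^ 2 + p 3 ^ 2 = p 0 ^ 2 - 1 := by linarith
  have h4 : v 1 ^ 2 + v 2 ^ 2 + v 3 ^ 2 = v 0 ^ 2 + 1 := by linarith
  rw [h2, h3, h4] at h1
  nlinarith

/-- The geodesic flow: the velocity of `γ_u` at time `t`. -/
def flow (t : ℝ) (u : UnitTangent) : UnitTangent where
  base := u.geod t
  dir := u.vel t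
  base_mem := by
    have hlt := abs_lt.1 u.abs_dir_lt
    obtain ⟨p, v, ⟨hp, hp0⟩, hpv, hv⟩ := u
    have hc := Real.cosh_sq t
    refine ⟨?_, ?_⟩
    · simp only [mink, geod, Pi.add_apply, Pi.smul_apply, smul_eq_mul] at hp hpv hv ⊢
      linear_combination (Real.cosh t) ^ 2 * hp + (Real.sinh t) ^ 2 * hv
        + 2 * Real.cosh t * Real.sinh t * hpv - hc
    · simp only [geod, Pi.add_apply, Pi.smul_apply, smul_eq_mul]
      have e1 := Real.exp_pos t
      have e2 := Real.exp_pos (-t)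
      rw [Real.cosh_eq, Real.sinh_eq]
      simp only at hlt
      nlinarith [mul_pos e1 (show 0 < p 0 + v 0 by linarith),
        mul_pos e2 (show 0 < p 0 - v 0 by linarith)]
  orth := by
    obtain ⟨p, v, ⟨hp, hp0⟩, hpv, hv⟩ := u
    have hc := Real.cosh_sq t
    simp only [mink, geod, vel, Pi.add_apply, Pi.smul_apply, smul_eq_mul] at hp hpv hv ⊢
    linear_combination Real.cosh t * Real.sinh t * hp + Real.cosh t * Real.sinh t * hv
        + (Real.cosh t ^ 2 + Real.sinh t ^ 2) * hpv
  unit := by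
    obtain ⟨p, v, ⟨hp, hp0⟩, hpv, hv⟩ := u
    have hc := Real.cosh_sq t
    simp only [mink, vel, Pi.add_apply, Pi.smul_apply, smul_eq_mul] at hp hpv hv ⊢
    linear_combination (Real.sinh t) ^ 2 * hp + (Real.cosh t) ^ 2 * hv
        + 2 * Real.cosh t * Real.sinh t * hpv + hc

/-- The opposite vector; `γ_{-u}(s) = γ_u(-s)`. -/
def reverse (u : UnitTangent) : UnitTangent where
  base := u.base
  dir := -u.dir
  base_mem := u.base_mem
  orth := by
    have := u.orth
    simp only [mink, Pi.neg_apply] at *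
    linarith
  unit := by
    have := u.unit
    simp only [mink, Pi.neg_apply] at *
    linarith

theorem flow_zero (u : UnitTangent) : u.flow 0 = u := by
  ext <;> simp [flow, geod, vel]

theorem flow_flow (s t : ℝ) (u : UnitTangent) : (u.flow t).flow s = u.flow (s + t) := by
  ext i <;> simp [flow, geod, vel, Real.cosh_add, Real.sinh_add] <;> ring

/-- Two unit vectors are tangent to the same oriented geodesic. -/
instance geodSetoid : Setoid UnitTangent where
  r u w := ∃ t : ℝ, w = u.flow t
  iseqv :=
    { refl := fun u => ⟨0, u.flow_zero.symm⟩
      symm := by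
        rintro u w ⟨t, rfl⟩
        exact ⟨-t, by rw [flow_flow, neg_add_cancel, flow_zero]⟩
      trans := by
        rintro u v w ⟨t, rfl⟩ ⟨s, rfl⟩
        exact ⟨s + t, flow_flow s t u⟩ }

end UnitTangent

/-! ## Smooth maps between subsets of Euclidean spaces

The spaces below are smooth submanifolds of vector spaces: a space `X` comes with an injective map
`eX` into a finite dimensional vector space, whose image is an embedded submanifold.  Smoothness,
tangent vectors and local diffeomorphisms have their usual meaning for subsets of vector spaces. -/

/-- `f` is smooth on the subset `S` of `X`: locally it is the restriction of a smooth map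
defined on an open subset of the ambient vector space. -/
def SmoothOn {X Y E F : Type*} [NormedAddCommGroup E] [NormedSpace ℝ E]
    [NormedAddCommGroup F] [NormedSpace ℝ F] (eX : X → E) (eY : Y → F) (S : Set X)
    (f : X → Y) : Prop :=
  ∀ x ∈ S, ∃ (U : Set E) (G : E → F), IsOpen U ∧ eX x ∈ U ∧ ContDiffOn ℝ ∞ G U ∧
    ∀ y ∈ S, eX y ∈ U → eY (f y) = G (eX y)

/-- `f : M → Y` is a local diffeomorphism, where `M` is a submanifold of `X`: every point of `M`
has an open neighbourhood in `M` (of the form `M ∩ U`) that `f` maps diffeomorphically onto an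
open subset of `Y` (given by `W`), with inverse `g`. -/
def IsLocalDiffeoOn {X Y E F : Type*} [NormedAddCommGroup E] [NormedSpace ℝ E]
    [NormedAddCommGroup F] [NormedSpace ℝ F] (eX : X → E) (eY : Y → F) (M : Set X)
    (f : X → Y) : Prop :=
  ∀ x ∈ M, ∃ (U : Set E) (W : Set F) (g : Y → X), IsOpen U ∧ IsOpen W ∧ eX x ∈ U ∧
    (∀ y ∈ M, eX y ∈ U → eY (f y) ∈ W ∧ g (f y) = y) ∧
    (∀ z : Y, eY z ∈ W → g z ∈ M ∧ eX (g z) ∈ U ∧ f (g z) = z) ∧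
    SmoothOn eX eY (M ∩ eX ⁻¹' U) f ∧ SmoothOn eY eX (eY ⁻¹' W) g

/-- The tangent space `T_x M` of a submanifold `M` of `X`: the initial velocities of the smooth
curves in `M` that start at `x`. -/
def tangentSet {X E : Type*} [NormedAddCommGroup E] [NormedSpace ℝ E] (eX : X → E) (M : Set X)
    (x : X) : Set E :=
  {w | ∃ (c : ℝ → X) (ε : ℝ), 0 < ε ∧ c 0 = x ∧ (∀ t ∈ Set.Ioo (-ε) ε, c t ∈ M) ∧
    ContDiffOn ℝ ∞ (fun t => eX (c t)) (Set.Ioo (-ε) ε) ∧ HasDerivAt (fun t => eX (c t)) w 0}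

/-! ## The space of oriented geodesics -/

/-- The space `𝓛` of complete oriented geodesics of `ℍ³`: unit speed geodesics up to orientation
preserving reparametrization. -/
def OrientedGeodesic : Type := Quotient UnitTangent.geodSetoid

/-- The oriented geodesic `[γ_u]`. -/
def UnitTangent.line (u : UnitTangent) : OrientedGeodesic := Quotient.mk _ u

/-- The wedge product of two vectors, as an antisymmetric matrix. -/
def wedge (x y : R4) : Fin 4 → Fin 4 → ℝ := fun i j => x i * y j - y i * x j

/-- The Plücker embedding `[γ] ↦ γ ∧ γ̇` of `𝓛`; it gives `𝓛` the differentiable structure for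
which `u ↦ [γ_u]` is a smooth submersion. -/
def plucker : OrientedGeodesic → (Fin 4 → Fin 4 → ℝ) :=
  Quotient.lift (fun u : UnitTangent => wedge u.base u.dir) (by
    rintro u w ⟨t, rfl⟩
    funext i j
    have hc := Real.cosh_sq t
    simp only [wedge, UnitTangent.flow, UnitTangent.geod, UnitTangent.vel, Pi.add_apply,
      Pi.smul_apply, smul_eq_mul]
    linear_combination (u.dir i * u.base j - u.base i * u.dir j) * hc)

/-- The smooth vector field `J` along `γ_u` belongs to `𝓙_γ`: it is tangent to `ℍ³`, orthogonal to
the velocity, and satisfies the Jacobi equation `J'' + R(J, γ̇)γ̇ = 0`. -/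
structure IsNormalJacobi (u : UnitTangent) (J : ℝ → R4) : Prop where
  smooth : ContDiff ℝ ∞ J
  tangent : ∀ s, mink (u.geod s) (J s) = 0
  orth : ∀ s, mink (u.vel s) (J s) = 0
  jacobi : ∀ s, covDerivAlong u.geod (covDerivAlong u.geod J) s
    + curv (J s) (u.vel s) (u.vel s) = 0

/-- The canonical isomorphism `T_γ : 𝓙_γ → T_{[γ]} 𝓛`.  If `γ_t` is a variation of `γ` by unit speed
geodesics associated with `J`, then `T_γ(J)` is the derivative of `t ↦ [γ_t]` at `0`, which in the
Plücker embedding is `J(0) ∧ γ̇(0) + γ(0) ∧ J'(0)`. -/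
def jacobiToTangent (u : UnitTangent) (J : ℝ → R4) : Fin 4 → Fin 4 → ℝ :=
  wedge (J 0) u.dir + wedge u.base (covDerivAlong u.geod J 0)

theorem hasDerivAt_plucker_variation (u : ℝ → UnitTangent) (J : ℝ → R4)
    (h : ∀ s, HasDerivAt (fun t => (u t).geod s) (J s) 0) :
    HasDerivAt (fun t => plucker (u t).line) (jacobiToTangent (u 0) J) 0 := by
  have hb : HasDerivAt (fun t => (u t).base) (J 0) 0 := by
    simpa [UnitTangent.geod] using h 0
  have hs1 : Real.sinh 1 ≠ 0 := (Real.sinh_pos_iff.2 one_pos).ne'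
  obtain ⟨w, hw⟩ : ∃ w, HasDerivAt (fun t => (u t).dir) w 0 := by
    refine ⟨(Real.sinh 1)⁻¹ • (J 1 - Real.cosh 1 • J 0), ?_⟩
    have e : (fun t => (u t).dir)
        = fun t => (Real.sinh 1)⁻¹ • ((u t).geod 1 - Real.cosh 1 • (u t).base) := by
      funext t
      simp [UnitTangent.geod, smul_smul, hs1]
    rw [e]
    exact ((h 1).sub (hb.const_smul (Real.cosh 1))).const_smul (Real.sinh 1)⁻¹
  have hJ : J = fun s => Real.cosh s • J 0 + Real.sinh s • w := by
    funext s
    exact (h s).unique ((hb.const_smul (Real.cosh s)).add (hw.const_smul (Real.sinh s)))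
  have hJ' : deriv J 0 = w := by
    have := ((Real.hasDerivAt_cosh 0).smul_const (J 0)).add
      ((Real.hasDerivAt_sinh 0).smul_const w)
    rw [hJ]
    refine (this.deriv).trans ?_
    simp
  rw [hasDerivAt_pi]
  intro i
  rw [hasDerivAt_pi]
  intro j
  have b := hasDerivAt_pi.1 hb
  have d := hasDerivAt_pi.1 hw
  refine (((b i).mul (d j)).sub ((d i).mul (b j))).congr_deriv ?_
  simp only [jacobiToTangent, covDerivAlong, tproj, hJ', wedge, Pi.add_apply, Pi.smul_apply,
    smul_eq_mul, UnitTangent.geod, Real.cosh_zero, Real.sinh_zero, one_smul, zero_smul, add_zero]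
  ring

/-- The square norm `‖T_γ(J)‖_× = ⟨γ̇ × J, J'⟩` (constant along `γ`, evaluated at `0`). -/
def normCross (u : UnitTangent) (J : ℝ → R4) : ℝ :=
  mink (cross u.base u.dir (J 0)) (covDerivAlong u.geod J 0)

/-- The square norm `‖T_γ(J)‖_K = |J|² - |J'|²` (constant along `γ`, evaluated at `0`). -/
def normK (u : UnitTangent) (J : ℝ → R4) : ℝ :=
  mink (J 0) (J 0) - mink (covDerivAlong u.geod J 0) (covDerivAlong u.geod J 0)

/-- `M ⊆ 𝓛` is semidefinite: a nonzero `X ∈ TM` has `‖X‖_× = 0` only if `‖X‖_K > 0`.  Tangent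
vectors are written as `X = T_γ(J)`. -/
def IsSemidefinite (M : Set OrientedGeodesic) : Prop :=
  ∀ (u : UnitTangent) (J : ℝ → R4), u.line ∈ M → IsNormalJacobi u J →
    jacobiToTangent u J ∈ tangentSet plucker M u.line → jacobiToTangent u J ≠ 0 →
    normCross u J = 0 → 0 < normK u J

/-- `g_×` induces a definite metric on `M ⊆ 𝓛`: it is positive definite on all tangent spaces of
`M` or negative definite on all of them. -/
def InducesDefinite (M : Set OrientedGeodesic) : Prop :=
  (∀ (u : UnitTangent) (J : ℝ → R4), u.line ∈ M → IsNormalJacobi u J →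
    jacobiToTangent u J ∈ tangentSet plucker M u.line → jacobiToTangent u J ≠ 0 →
    0 < normCross u J) ∨
  (∀ (u : UnitTangent) (J : ℝ → R4), u.line ∈ M → IsNormalJacobi u J →
    jacobiToTangent u J ∈ tangentSet plucker M u.line → jacobiToTangent u J ≠ 0 →
    normCross u J < 0)

/-! ## The sphere at infinity and the Gauss maps -/

/-- The geodesics `γ_u` and `γ_w` are asymptotic. -/
def Asymptotic (u w : UnitTangent) : Prop :=
  ∃ C : ℝ, 0 < C ∧ ∀ s : ℝ, 0 ≤ s → hdist (u.geod s) (w.geod s) ≤ C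

/-- The base point `o = (1, 0, 0, 0)` of `ℍ³`. -/
def origin : R4 := Pi.single 0 1

/-- The unit vector at the base point `o` that is asymptotic to `u`. -/
def asymDir (u : UnitTangent) : R4 :=
  (u.base 0 + u.dir 0)⁻¹ • (u.base + u.dir) - origin

theorem nullSum_pos (u : UnitTangent) : 0 < u.base 0 + u.dir 0 := by
  linarith [abs_lt.1 u.abs_dir_lt]

theorem mink_nullSum (u : UnitTangent) : mink (u.base + u.dir) (u.base + u.dir) = 0 := by
  obtain ⟨p, v, ⟨hp, hp0⟩, hpv, hv⟩ := u
  simp only [mink, Pi.add_apply] at hp hpv hv ⊢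
  linarith

/-- The unit vector `asymDir u` at the base point `o`. -/
def asymVector (u : UnitTangent) : UnitTangent where
  base := origin
  dir := asymDir u
  base_mem := by simp [H3, mink, origin]
  orth := by
    have := inv_mul_cancel₀ (nullSum_pos u).ne'
    rw [mul_add] at this
    simp [mink, asymDir, origin, this]
  unit := by
    have h := (nullSum_pos u).ne'
    have h2 := mink_nullSum u
    simp only [mink, asymDir, origin, Pi.add_apply, Pi.sub_apply, Pi.smul_apply, smul_eq_mul,
      Pi.single_eq_same, ne_eq, Fin.reduceEq, not_false_eq_true, Pi.single_eq_of_ne] at *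
    field_simp
    linarith

theorem asymDir_asymVector (u : UnitTangent) : asymDir (asymVector u) = asymDir u := by
  have h : (asymVector u).base 0 + (asymVector u).dir 0 = 1 := by
    have := inv_mul_cancel₀ (nullSum_pos u).ne'
    rw [mul_add] at this
    simp [asymVector, asymDir, origin, this]
  rw [asymDir, h]
  simp [asymVector]

theorem mink_nullSum_eq_zero_iff (u w : UnitTangent) :
    mink (u.base + u.dir) (w.base + w.dir) = 0 ↔ asymDir u = asymDir w := by
  have hu := nullSum_pos u
  have hw := nullSum_pos w
  have hu2 := mink_nullSum u
  have hw2 := mink_nullSum w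
  unfold asymDir
  change 0 < (u.base + u.dir) 0 at hu
  change 0 < (w.base + w.dir) 0 at hw
  change _ ↔ ((u.base + u.dir) 0)⁻¹ • (u.base + u.dir) - origin
    = ((w.base + w.dir) 0)⁻¹ • (w.base + w.dir) - origin
  generalize u.base + u.dir = N at *
  generalize w.base + w.dir = K at *
  constructor
  · intro h
    have hs : (N 1 * K 0 - K 1 * N 0) ^ 2 + (N 2 * K 0 - K 2 * N 0) ^ 2
        + (N 3 * K 0 - K 3 * N 0) ^ 2 = 0 := by
      simp only [mink] at *
      linear_combination K 0 ^ 2 * hu2 + N 0 ^ 2 * hw2 - 2 * N 0 * K 0 * h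
    have s1 := sq_nonneg (N 1 * K 0 - K 1 * N 0)
    have s2 := sq_nonneg (N 2 * K 0 - K 2 * N 0)
    have s3 := sq_nonneg (N 3 * K 0 - K 3 * N 0)
    have a1 : N 1 * K 0 - K 1 * N 0 = 0 := pow_eq_zero_iff two_ne_zero |>.1 (by linarith)
    have a2 : N 2 * K 0 - K 2 * N 0 = 0 := pow_eq_zero_iff two_ne_zero |>.1 (by linarith)
    have a3 : N 3 * K 0 - K 3 * N 0 = 0 := pow_eq_zero_iff two_ne_zero |>.1 (by linarith)
    congr 1
    funext i
    simp only [Pi.smul_apply, smul_eq_mul]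
    fin_cases i
    · simp [hu.ne', hw.ne']
    all_goals simp only [Fin.reduceFinMk, Fin.mk_one]; field_simp; linarith
  · intro h
    have h' : (N 0)⁻¹ • N = (K 0)⁻¹ • K := by simpa using h
    have hK : K = (K 0 * (N 0)⁻¹) • N := by
      rw [mul_smul, h', smul_smul, mul_inv_cancel₀ hw.ne', one_smul]
    rw [hK]
    simp only [mink, Pi.smul_apply, smul_eq_mul] at *
    linear_combination (K 0 * (N 0)⁻¹) * hu2

theorem neg_mink_geod (u w : UnitTangent) (s : ℝ) : -mink (u.geod s) (w.geod s) =
    -(Real.exp (2 * s) * mink (u.base + u.dir) (w.base + w.dir)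
      + (mink (u.base + u.dir) (w.base - w.dir) + mink (u.base - u.dir) (w.base + w.dir))
      + Real.exp (-(2 * s)) * mink (u.base - u.dir) (w.base - w.dir)) / 4 := by
  have h1 : Real.exp (2 * s) = Real.exp s ^ 2 := by rw [← Real.exp_nat_mul]; norm_num
  have h2 : Real.exp (-(2 * s)) = Real.exp (-s) ^ 2 := by rw [← Real.exp_nat_mul]; ring_nf
  have h3 : Real.exp s * Real.exp (-s) = 1 := by rw [← Real.exp_add]; simp
  rw [h1, h2]
  simp only [mink, UnitTangent.geod, Pi.add_apply, Pi.sub_apply, Pi.smul_apply, smul_eq_mul,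
    Real.cosh_eq, Real.sinh_eq]
  have e : ∀ x y : R4, mink x y = -(x 0 * y 0) + x 1 * y 1 + x 2 * y 2 + x 3 * y 3 :=
    fun _ _ => rfl
  have h4 := e (u.base + u.dir) (w.base - w.dir)
  have h5 := e (u.base - u.dir) (w.base + w.dir)
  simp only [Pi.add_apply, Pi.sub_apply] at h4 h5
  linear_combination (-1 / 4 : ℝ) * (mink (u.base + u.dir) (w.base - w.dir)
      + mink (u.base - u.dir) (w.base + w.dir)) * h3
      + (1 / 4 : ℝ) * (Real.exp s * Real.exp (-s) - 1) * (h4 + h5)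

theorem one_le_neg_mink {p q : R4} (hp : p ∈ H3) (hq : q ∈ H3) : 1 ≤ -mink p q := by
  obtain ⟨hp, hp0⟩ := hp
  obtain ⟨hq, hq0⟩ := hq
  simp only [mink] at *
  have hc : (1 + (p 1 * q 1 + p 2 * q 2 + p 3 * q 3)) ^ 2
      ≤ (1 + (p 1 ^ 2 + p 2 ^ 2 + p 3 ^ 2)) * (1 + (q 1 ^ 2 + q 2 ^ 2 + q 3 ^ 2)) := by
    nlinarith [sq_nonneg (p 1 * q 2 - p 2 * q 1), sq_nonneg (p 1 * q 3 - p 3 * q 1),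
      sq_nonneg (p 2 * q 3 - p 3 * q 2), sq_nonneg (p 1 - q 1), sq_nonneg (p 2 - q 2),
      sq_nonneg (p 3 - q 3)]
  have h3 : 1 + (p 1 ^ 2 + p 2 ^ 2 + p 3 ^ 2) = p 0 ^ 2 := by linarith
  have h4 : 1 + (q 1 ^ 2 + q 2 ^ 2 + q 3 ^ 2) = q 0 ^ 2 := by linarith
  rw [h3, h4, ← mul_pow] at hc
  linarith [le_trans (le_abs_self _) (abs_le_of_sq_le_sq hc (mul_pos hp0 hq0).le)]

theorem asymptotic_iff (u w : UnitTangent) : Asymptotic u w ↔ asymDir u = asymDir w := by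
  rw [← mink_nullSum_eq_zero_iff]
  have hmem : ∀ (x : UnitTangent) s, x.geod s ∈ H3 := fun x s => (x.flow s).base_mem
  set a := mink (u.base + u.dir) (w.base + w.dir) with ha
  set b := mink (u.base + u.dir) (w.base - w.dir) + mink (u.base - u.dir) (w.base + w.dir) with hb
  set d := mink (u.base - u.dir) (w.base - w.dir) with hd
  constructor
  · rintro ⟨C, hC, h⟩
    have hbd : ∀ s : ℝ, 0 ≤ s → |Real.exp (2 * s) * a| ≤ 4 * Real.cosh C + |b| + |d| := by
      intro s hs
      have h1 := one_le_neg_mink (hmem u s) (hmem w s)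
      have h2 : -mink (u.geod s) (w.geod s) ≤ Real.cosh C := by
        rw [← Real.cosh_arcosh h1]
        exact Real.cosh_le_cosh.2 (by
          rw [abs_of_nonneg (Real.arcosh_nonneg h1), abs_of_pos hC]; exact h s hs)
      rw [neg_mink_geod, ← ha, ← hb, ← hd] at h1 h2
      have h3 : |Real.exp (-(2 * s)) * d| ≤ |d| := by
        rw [abs_mul, abs_of_pos (Real.exp_pos _)]
        exact mul_le_of_le_one_left (abs_nonneg _) (Real.exp_le_one_iff.2 (by linarith))
      have hb' := abs_le.1 (le_refl |b|)
      have hd' := abs_le.1 h3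
      rw [abs_le]
      constructor <;> linarith [Real.cosh_pos C]
    by_contra hne
    have hpos : 0 < |a| := abs_pos.2 hne
    set K := 4 * Real.cosh C + |b| + |d| with hK
    have hK0 : 0 < K := by positivity
    have h1 := hbd (K / |a|) (by positivity)
    rw [abs_mul, abs_of_pos (Real.exp_pos _)] at h1
    have h2 := Real.add_one_le_exp (2 * (K / |a|))
    have h3 : (2 * (K / |a|) + 1) * |a| ≤ K :=
      le_trans (mul_le_mul_of_nonneg_right h2 hpos.le) h1
    have h4 : K / |a| * |a| = K := div_mul_cancel₀ _ hpos.ne'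
    nlinarith
  · intro h
    refine ⟨Real.arcosh (1 + |b| + |d|) + 1, ?_, ?_⟩
    · have := Real.arcosh_nonneg (x := 1 + |b| + |d|) (by linarith [abs_nonneg b, abs_nonneg d])
      linarith
    · intro s hs
      have h1 := one_le_neg_mink (hmem u s) (hmem w s)
      have h3 : |Real.exp (-(2 * s)) * d| ≤ |d| := by
        rw [abs_mul, abs_of_pos (Real.exp_pos _)]
        exact mul_le_of_le_one_left (abs_nonneg _) (Real.exp_le_one_iff.2 (by linarith))
      have h2 : -mink (u.geod s) (w.geod s) ≤ 1 + |b| + |d| := by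
        rw [neg_mink_geod, ← ha, ← hb, ← hd, h]
        have hb' := abs_le.1 (le_refl |b|)
        have hd' := abs_le.1 h3
        have := abs_nonneg b
        have := abs_nonneg d
        linarith
      have := (Real.arcosh_le_arcosh (by linarith) (by linarith)).2 h2
      unfold hdist
      linarith

/-- The equivalence relation of being asymptotic. -/
def asymSetoid : Setoid UnitTangent where
  r := Asymptotic
  iseqv :=
    { refl := fun u => (asymptotic_iff u u).2 rfl
      symm := fun h => (asymptotic_iff _ _).2 ((asymptotic_iff _ _).1 h).symm
      trans := fun h k => (asymptotic_iff _ _).2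
        (((asymptotic_iff _ _).1 h).trans ((asymptotic_iff _ _).1 k)) }

/-- The points at infinity `ℍ³(∞)`: the classes of asymptotic unit speed geodesics. -/
def Boundary : Type := Quotient asymSetoid

/-- The point at infinity `γ_u(∞)`. -/
def UnitTangent.atInfinity (u : UnitTangent) : Boundary := Quotient.mk asymSetoid u

/-- The canonical differentiable structure of `ℍ³(∞)`: a point at infinity is identified with the
unit vector at `o` (an element of a round two-sphere in `T_o ℍ³`) whose geodesic represents it. -/
def boundaryEmb : Boundary → R4 :=
  Quotient.lift asymDir (fun u w h => (asymptotic_iff u w).1 h)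

theorem boundaryEmb_spec (u : UnitTangent) :
    (asymVector u).base = origin ∧ (asymVector u).dir = boundaryEmb u.atInfinity ∧
      (asymVector u).atInfinity = u.atInfinity :=
  ⟨rfl, rfl, Quotient.sound ((asymptotic_iff _ _).2 (asymDir_asymVector u))⟩

theorem asymDir_flow (t : ℝ) (u : UnitTangent) : asymDir (u.flow t) = asymDir u := by
  have hN : (u.flow t).base + (u.flow t).dir = Real.exp t • (u.base + u.dir) := by
    simp only [UnitTangent.flow, UnitTangent.geod, UnitTangent.vel, ← Real.cosh_add_sinh]
    module
  have hN0 : (u.flow t).base 0 + (u.flow t).dir 0 = Real.exp t * (u.base 0 + u.dir 0) :=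
    congrFun hN 0
  rw [asymDir, hN, hN0, asymDir, smul_smul, mul_inv, mul_right_comm,
    inv_mul_cancel₀ (Real.exp_pos t).ne', one_mul]

theorem reverse_flow (t : ℝ) (u : UnitTangent) : (u.flow t).reverse = u.reverse.flow (-t) := by
  ext i
  · simp [UnitTangent.flow, UnitTangent.reverse, UnitTangent.geod]
  · simp [UnitTangent.flow, UnitTangent.reverse, UnitTangent.geod, UnitTangent.vel]
    ring

/-- The forward Gauss map `φ⁺([γ]) = γ(∞)`. -/
def gaussForward : OrientedGeodesic → Boundary :=
  Quotient.lift UnitTangent.atInfinity (by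
    rintro u w ⟨t, rfl⟩
    exact Quotient.sound ((asymptotic_iff _ _).2 (asymDir_flow t u).symm))

/-- The backward Gauss map `φ⁻([γ]) = γ(-∞)`, the forward endpoint of the reversed geodesic. -/
def gaussBackward : OrientedGeodesic → Boundary :=
  Quotient.lift (fun u : UnitTangent => u.reverse.atInfinity) (by
    rintro u w ⟨t, rfl⟩
    refine Quotient.sound ((asymptotic_iff _ _).2 ?_)
    rw [reverse_flow, asymDir_flow])

/-! ## Geodesic foliations -/

/-- `V` is a smooth unit vector field on `ℍ³` all of whose integral curves are geodesics
(`∇_ċ ċ = 0`).  Only the values of `V` on `ℍ³` matter. -/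
structure IsGeodesicFoliation (V : R4 → R4) : Prop where
  smooth : SmoothOn (id : R4 → R4) (id : R4 → R4) H3 V
  tangent : ∀ p ∈ H3, mink p (V p) = 0
  unit : ∀ p ∈ H3, mink (V p) (V p) = 1
  geodesic : ∀ (c : ℝ → R4) (a b : ℝ),
    (∀ t ∈ Set.Ioo a b, c t ∈ H3 ∧ HasDerivAt c (V (c t)) t) →
    ∀ t ∈ Set.Ioo a b, covDerivAlong c (deriv c) t = 0

/-- The space of leaves `𝓜 ⊆ 𝓛` of the foliation: the oriented geodesics tangent to `V`. -/
def leafSpace (V : R4 → R4) : Set OrientedGeodesic :=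
  {ℓ | ∃ u : UnitTangent, u.dir = V u.base ∧ u.line = ℓ}

/-- Semi-nondegenerate: both Gauss maps `φ^± : 𝓜 → ℍ³(∞)` are local diffeomorphisms. -/
def IsSemiNondegenerate (V : R4 → R4) : Prop :=
  IsLocalDiffeoOn plucker boundaryEmb (leafSpace V) gaussForward ∧
  IsLocalDiffeoOn plucker boundaryEmb (leafSpace V) gaussBackward

/-- Nondegenerate: at every point `p`, the only eigenvectors of `u ↦ ∇_u V` on `T_p ℍ³` are in
`ℝ V(p)`. -/
def IsNondegenerate (V : R4 → R4) : Prop :=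
  ∀ p ∈ H3, ∀ u : R4, mink p u = 0 → u ≠ 0 → ∀ k : ℝ, covDeriv V p u = k • u →
    ∃ a : ℝ, u = a • V p

end HypFoliation

end

/-!
In the hyperboloid model a unit vector `v` at `p` spans the geodesic `cosh t • p + sinh t • v`, and
the normal Jacobi fields along it are `cosh t • a + sinh t • b` with `a`, `b` in the normal plane
`N`, the Lorentz orthogonal complement of `p` and `v`.  Picard-Lindelöf and a connectedness argument
turn the hypothesis on integral curves into the statement that the complete geodesics tangent to `V`
are integral curves (`IsGeodesicFoliation.isLeafField`).  The curves in the space of leaves lift to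
curves of points of `ℍ³` on the leaves, so its tangent vectors are the Jacobi fields with
`b = ∇_a V`, `a ∈ N` (`IsLeafField.mem_tangentSet_iff`).  Both metrics become forms on `N`:
`‖a‖_× = ⟨V × a, ∇_a V⟩`, which vanishes exactly when `a` is an eigenvector of `∇V`, and
`‖a‖_K = |a|² - |∇_a V|²`.

For part (b), `∇_V V = 0` and `∇V` preserves `N`, so that nondegeneracy means that `∇V` has no
eigenvectors in `N`, that is, `g_×` has no null directions.  A quadratic form without null
directions on a plane is definite, and its sign cannot change since `ℍ³` is connected
(`IsLeafField.cross_definite`).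

For part (a), an eigenvalue `k` of `∇V` on `N` satisfies `|k| ≤ 1`: otherwise the Jacobi field
`(cosh t + k sinh t) a` would vanish at some time together with its derivative, the image of its
value under `∇V` (`IsLeafField.sq_eigenvalue_le_one`). Hence `g_K` is positive on the null
directions of `g_×` if and only if `1` and `-1` are not eigenvalues on `N`. The differentials of
the Gauss maps are, up to normalization, `a ↦ a + ∇_a V` and `a ↦ a - ∇_a V`, so this is the
condition that they are injective. The inverse function theorem is applied to the map `x ↦ x + V x`
of Minkowski space, with `V` extended constantly along rays: it sends `x` to a null vector exactly
when `x` lies on `ℍ³`, and this null vector represents the endpoint of the leaf through `x`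
(`IsLeafField.gaussForward_of_injective`). The backward Gauss map is the forward Gauss map of `-V`.
-/

open scoped ContDiff

namespace HypFoliation

/-! ### Minkowski algebra -/

theorem mink_comm (x y : R4) : mink x y = mink y x := by simp only [mink]; ring

theorem mink_add_left (x y z : R4) : mink (x + y) z = mink x z + mink y z := by
  simp only [mink, Pi.add_apply]; ring

theorem mink_add_right (x y z : R4) : mink x (y + z) = mink x y + mink x z := by
  simp only [mink, Pi.add_apply]; ring

theorem mink_sub_left (x y z : R4) : mink (x - y) z = mink x z - mink y z := by
  simp only [mink, Pi.sub_apply]; ring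

theorem mink_sub_right (x y z : R4) : mink x (y - z) = mink x y - mink x z := by
  simp only [mink, Pi.sub_apply]; ring

theorem mink_smul_left (k : ℝ) (x y : R4) : mink (k • x) y = k * mink x y := by
  simp only [mink, Pi.smul_apply, smul_eq_mul]; ring

theorem mink_smul_right (k : ℝ) (x y : R4) : mink x (k • y) = k * mink x y := by
  simp only [mink, Pi.smul_apply, smul_eq_mul]; ring

theorem mink_neg_left (x y : R4) : mink (-x) y = -mink x y := by
  simp only [mink, Pi.neg_apply]; ring

theorem mink_neg_right (x y : R4) : mink x (-y) = -mink x y := by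
  simp only [mink, Pi.neg_apply]; ring

@[simp] theorem mink_zero_left (x : R4) : mink 0 x = 0 := by simp [mink]

@[simp] theorem mink_zero_right (x : R4) : mink x 0 = 0 := by simp [mink]

theorem _root_.ContDiff.mink {E : Type*} [NormedAddCommGroup E] [NormedSpace ℝ E] {n : WithTop ℕ∞}
    {f g : E → R4} (hf : ContDiff ℝ n f) (hg : ContDiff ℝ n g) :
    ContDiff ℝ n fun x => mink (f x) (g x) := by
  have hf' := contDiff_pi.1 hf
  have hg' := contDiff_pi.1 hg
  exact ((((hf' 0).mul (hg' 0)).neg.add ((hf' 1).mul (hg' 1))).add ((hf' 2).mul (hg' 2))).add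
    ((hf' 3).mul (hg' 3))

theorem _root_.Continuous.mink {X : Type*} [TopologicalSpace X] {f g : X → R4}
    (hf : Continuous f) (hg : Continuous g) : Continuous fun x => mink (f x) (g x) := by
  unfold HypFoliation.mink; fun_prop

theorem _root_.HasDerivAt.mink {c d : ℝ → R4} {c' d' : R4} {t : ℝ} (hc : HasDerivAt c c' t)
    (hd : HasDerivAt d d' t) :
    HasDerivAt (fun t => mink (c t) (d t)) (mink c' (d t) + mink (c t) d') t := by
  have hc' := hasDerivAt_pi.1 hc
  have hd' := hasDerivAt_pi.1 hd
  refine (((((hc' 0).mul (hd' 0)).neg.add ((hc' 1).mul (hd' 1))).add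
    ((hc' 2).mul (hd' 2))).add ((hc' 3).mul (hd' 3))).congr_deriv ?_
  simp only [HypFoliation.mink]; ring

/-- Tangent vectors of `ℍ³` are spacelike, in a quantitative form. -/
theorem sq_le_mink_self_of_orth {p a : R4} (hp : p ∈ H3) (ha : mink p a = 0) :
    a 1 ^ 2 + a 2 ^ 2 + a 3 ^ 2 ≤ p 0 ^ 2 * mink a a := by
  obtain ⟨hp, hp0⟩ := hp
  simp only [mink] at *
  have h1 : (p 1 * a 1 + p 2 * a 2 + p 3 * a 3) ^ 2
      ≤ (p 1 ^ 2 + p 2 ^ 2 + p 3 ^ 2) * (a 1 ^ 2 + a 2 ^ 2 + a 3 ^ 2) := by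
    nlinarith [sq_nonneg (p 1 * a 2 - p 2 * a 1), sq_nonneg (p 1 * a 3 - p 3 * a 1),
      sq_nonneg (p 2 * a 3 - p 3 * a 2)]
  have h2 : p 1 * a 1 + p 2 * a 2 + p 3 * a 3 = p 0 * a 0 := by linarith
  have h3 : p 1 ^ 2 + p 2 ^ 2 + p 3 ^ 2 = p 0 ^ 2 - 1 := by linarith
  rw [h2, h3] at h1
  nlinarith

theorem mink_self_nonneg {p a : R4} (hp : p ∈ H3) (ha : mink p a = 0) : 0 ≤ mink a a := by
  have h := sq_le_mink_self_of_orth hp ha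
  have : 0 < p 0 ^ 2 := pow_pos hp.2 2
  by_contra hn
  nlinarith [sq_nonneg (a 1), sq_nonneg (a 2), sq_nonneg (a 3)]

theorem mink_self_eq_zero {p a : R4} (hp : p ∈ H3) (ha : mink p a = 0) (h0 : mink a a = 0) :
    a = 0 := by
  have h := sq_le_mink_self_of_orth hp ha
  rw [h0, mul_zero] at h
  have h1 : a 1 = 0 := by nlinarith [sq_nonneg (a 1), sq_nonneg (a 2), sq_nonneg (a 3)]
  have h2 : a 2 = 0 := by nlinarith [sq_nonneg (a 1), sq_nonneg (a 2), sq_nonneg (a 3)]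
  have h3 : a 3 = 0 := by nlinarith [sq_nonneg (a 1), sq_nonneg (a 2), sq_nonneg (a 3)]
  have hz : a 0 = 0 := by
    have := hp.2
    simp only [mink, h1, h2, h3] at ha
    have : p 0 * a 0 = 0 := by linarith
    rcases mul_eq_zero.1 this with h | h
    · linarith
    · exact h
  funext i
  fin_cases i <;> assumption

theorem mink_self_pos {p a : R4} (hp : p ∈ H3) (ha : mink p a = 0) (h0 : a ≠ 0) :
    0 < mink a a :=
  lt_of_le_of_ne (mink_self_nonneg hp ha) fun h => h0 (mink_self_eq_zero hp ha h.symm)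

/-- A timelike vector on the same side of a point of `ℍ³` lies in the future cone. -/
theorem zero_lt_of_mink_neg {p x : R4} (hp : p ∈ H3) (hx : mink x x < 0) (hxp : mink x p < 0) :
    0 < x 0 := by
  obtain ⟨hp, hp0⟩ := hp
  simp only [mink] at *
  by_contra! hn
  have h1 : (p 1 * x 1 + p 2 * x 2 + p 3 * x 3) ^ 2
      ≤ (p 1 ^ 2 + p 2 ^ 2 + p 3 ^ 2) * (x 1 ^ 2 + x 2 ^ 2 + x 3 ^ 2) := by
    nlinarith [sq_nonneg (p 1 * x 2 - p 2 * x 1), sq_nonneg (p 1 * x 3 - p 3 * x 1),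
      sq_nonneg (p 2 * x 3 - p 3 * x 2)]
  have h3 : p 1 ^ 2 + p 2 ^ 2 + p 3 ^ 2 = p 0 ^ 2 - 1 := by linarith
  have h4 : 0 ≤ -(p 0 * x 0) := by nlinarith
  have h5 : (p 0 * x 0) ^ 2 < (p 1 * x 1 + p 2 * x 2 + p 3 * x 3) ^ 2 := by
    nlinarith
  have h6 : 0 ≤ p 0 ^ 2 - 1 := by rw [← h3]; positivity
  have h7 := mul_le_mul_of_nonneg_left
    (show x 1 ^ 2 + x 2 ^ 2 + x 3 ^ 2 ≤ x 0 ^ 2 by linarith) h6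
  rw [h3] at h1
  nlinarith [sq_nonneg (x 0)]

/-- Laplace expansion of the determinant defining the cross product along its last row. -/
theorem mink_cross (p u v w : R4) :
    mink (cross p u v) w = Matrix.det (Matrix.of ![p, u, v, w]) := by
  simp [mink, cross, Matrix.det_succ_row_zero, Fin.sum_univ_succ, Fin.succAbove, Pi.single_apply]
  ring

/-- The Gram determinant of four vectors, two of which span a plane orthogonal to `p` and `v`. -/
theorem det_sq_eq {u : UnitTangent} {a b : R4} (hpa : mink u.base a = 0) (hva : mink u.dir a = 0)
    (hpb : mink u.base b = 0) (hvb : mink u.dir b = 0) :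
    mink (cross u.base u.dir a) b ^ 2 = mink a a * mink b b - mink a b ^ 2 := by
  have hp := u.base_mem.1
  have hpv := u.orth
  have hv := u.unit
  generalize u.base = p at *
  generalize u.dir = v at *
  rw [mink_cross]
  set X : Matrix (Fin 4) (Fin 4) ℝ := Matrix.of ![p, v, a, b] with hX
  have hG : X * Matrix.diagonal ![-1, 1, 1, 1] * X.transpose
      = !![-1, 0, 0, 0; 0, 1, 0, 0; 0, 0, mink a a, mink a b; 0, 0, mink a b, mink b b] := by
    have e : ∀ i j,
        (X * Matrix.diagonal ![-1, 1, 1, 1] * X.transpose : Matrix (Fin 4) (Fin 4) ℝ) i j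
          = mink ((![p, v, a, b] : Fin 4 → R4) i) ((![p, v, a, b] : Fin 4 → R4) j) := by
      intro i j
      rw [Matrix.mul_apply, Fin.sum_univ_four]
      simp only [Matrix.mul_diagonal, Matrix.transpose_apply, hX, Matrix.of_apply, mink,
        Matrix.cons_val]
      ring
    ext i j
    rw [e]
    fin_cases i <;> fin_cases j <;>
      simp [hp, hpv, hv, hpa, hva, hpb, hvb, mink_comm v p, mink_comm a p, mink_comm a v,
        mink_comm b p, mink_comm b v, mink_comm b a]
  have h := congrArg Matrix.det hG
  rw [Matrix.det_mul, Matrix.det_mul, Matrix.det_transpose, Matrix.det_diagonal] at h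
  have hd : Matrix.det !![-1, 0, 0, 0; 0, 1, 0, 0; 0, 0, mink a a, mink a b;
      0, 0, mink a b, mink b b] = -(mink a a * mink b b - mink a b ^ 2) := by
    simp [Matrix.det_succ_row_zero, Fin.sum_univ_succ, Fin.succAbove]
    ring
  rw [hd, Fin.prod_univ_four] at h
  simp only [Matrix.cons_val] at h
  linarith

/-- In the normal plane, `⟨v × a, b⟩` vanishes only if `b` is a multiple of `a`. -/
theorem exists_smul_of_cross_eq_zero {u : UnitTangent} {a b : R4} (hpa : mink u.base a = 0)
    (hva : mink u.dir a = 0) (hpb : mink u.base b = 0) (hvb : mink u.dir b = 0) (ha : a ≠ 0)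
    (h : mink (cross u.base u.dir a) b = 0) : ∃ k : ℝ, b = k • a := by
  have hd := det_sq_eq hpa hva hpb hvb
  have hpos := mink_self_pos u.base_mem hpa ha
  refine ⟨mink a b / mink a a, sub_eq_zero.1 (mink_self_eq_zero u.base_mem ?_ ?_)⟩
  · rw [mink_sub_right, mink_smul_right, hpa, hpb]; ring
  · simp only [mink_sub_right, mink_sub_left, mink_smul_left, mink_smul_right, mink_comm b a]
    field_simp
    rw [h] at hd
    linarith

theorem mink_cross_smul_self (p v a : R4) (k : ℝ) : mink (cross p v a) (k • a) = 0 := by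
  rw [mink_smul_right, mink_cross, Matrix.det_zero_of_row_eq (i := 2) (j := 3) (by decide) rfl,
    mul_zero]

theorem mink_cross_add_left (p v a b c : R4) :
    mink (cross p v (a + b)) c = mink (cross p v a) c + mink (cross p v b) c := by
  simp [mink_cross, Matrix.det_succ_row_zero, Fin.sum_univ_succ, Fin.succAbove]
  ring

theorem mink_cross_smul_left (p v a c : R4) (k : ℝ) :
    mink (cross p v (k • a)) c = k * mink (cross p v a) c := by
  simp [mink_cross, Matrix.det_succ_row_zero, Fin.sum_univ_succ, Fin.succAbove]
  ring

/-! ### The ray extension of a vector field -/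

/-- The open cone of future directed timelike vectors, the domain of `radialProj`. -/
def futureCone : Set R4 := {x | mink x x < 0 ∧ 0 < x 0}

theorem isOpen_futureCone : IsOpen futureCone :=
  (isOpen_lt (continuous_id.mink continuous_id) continuous_const).inter
    (isOpen_lt continuous_const (continuous_apply 0))

theorem H3_subset_futureCone : H3 ⊆ futureCone := fun p hp => ⟨by linarith [hp.1], hp.2⟩

theorem futureCone_mem_nhds {p : R4} (hp : p ∈ H3) : futureCone ∈ nhds p :=
  isOpen_futureCone.mem_nhds (H3_subset_futureCone hp)

theorem radialProj_mem {x : R4} (hx : x ∈ futureCone) : radialProj x ∈ H3 := by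
  have h : 0 < -mink x x := by linarith [hx.1]
  refine ⟨?_, ?_⟩
  · have h2 := Real.sq_sqrt h.le
    have h3 := (Real.sqrt_pos.2 h).ne'
    simp only [radialProj, mink_smul_left, mink_smul_right]
    field_simp
    linarith
  · simp only [radialProj, Pi.smul_apply, smul_eq_mul]
    exact mul_pos (inv_pos.2 (Real.sqrt_pos.2 h)) hx.2

theorem radialProj_eq {p : R4} (hp : p ∈ H3) : radialProj p = p := by
  simp [radialProj, hp.1]

theorem contDiffOn_radialProj : ContDiffOn ℝ ∞ radialProj futureCone := by
  intro x hx
  have h : -mink x x ≠ 0 := by linarith [hx.1]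
  have h1 : ContDiff ℝ ∞ fun x : R4 => -mink x x := (contDiff_id.mink contDiff_id).neg
  have h2 : ContDiffAt ℝ ∞ (fun x : R4 => Real.sqrt (-mink x x)) x := h1.contDiffAt.sqrt h
  exact ((h2.inv (Real.sqrt_ne_zero'.2 (by linarith [hx.1]))).smul contDiffAt_id).contDiffWithinAt

/-- The extension of a vector field from `ℍ³` to the future cone, constant along rays. -/
noncomputable def rayExt (V : R4 → R4) (x : R4) : R4 := V (radialProj x)

theorem rayExt_eq {V : R4 → R4} {p : R4} (hp : p ∈ H3) : rayExt V p = V p := by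
  rw [rayExt, radialProj_eq hp]

theorem contDiffOn_rayExt {V : R4 → R4} (hV : SmoothOn (id : R4 → R4) (id : R4 → R4) H3 V) :
    ContDiffOn ℝ ∞ (rayExt V) futureCone := by
  intro x hx
  obtain ⟨U, G, hU, hxU, hG, h⟩ := hV _ (radialProj_mem hx)
  have hr : ContDiffAt ℝ ∞ radialProj x :=
    contDiffOn_radialProj.contDiffAt (isOpen_futureCone.mem_nhds hx)
  have hc : ContDiffAt ℝ ∞ (G ∘ radialProj) x :=
    ContDiffAt.comp x (hG.contDiffAt (hU.mem_nhds hxU)) hr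
  refine (hc.congr_of_eventuallyEq ?_).contDiffWithinAt
  filter_upwards [isOpen_futureCone.mem_nhds hx, hr.continuousAt (hU.mem_nhds hxU)] with y hy hyU
  exact h _ (radialProj_mem hy) hyU

theorem mink_rayExt {V : R4 → R4} (ht : ∀ p ∈ H3, mink p (V p) = 0) {x : R4}
    (hx : x ∈ futureCone) : mink x (rayExt V x) = 0 := by
  have h1 := ht _ (radialProj_mem hx)
  have h2 : (Real.sqrt (-mink x x))⁻¹ ≠ 0 := inv_ne_zero (Real.sqrt_pos.2 (by linarith [hx.1])).ne'
  nth_rw 1 [radialProj] at h1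
  rw [mink_smul_left] at h1
  exact (mul_eq_zero.1 h1).resolve_left h2

/-- A smooth unit vector field on `ℍ³` that takes the velocity vectors of the complete geodesics
tangent to it as its values: the form in which a foliation by geodesics is used. -/
structure IsLeafField (V : R4 → R4) : Prop where
  smooth : ContDiffOn ℝ ∞ (rayExt V) futureCone
  tangent : ∀ p ∈ H3, mink p (V p) = 0
  unit : ∀ p ∈ H3, mink (V p) (V p) = 1
  flow : ∀ u : UnitTangent, u.dir = V u.base → ∀ t, u.vel t = V (u.geod t)

/-! ### The leaves are complete geodesics -/

theorem geod_hasDerivAt (u : UnitTangent) (s : ℝ) : HasDerivAt u.geod (u.vel s) s :=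
  ((Real.hasDerivAt_cosh s).smul_const u.base).add ((Real.hasDerivAt_sinh s).smul_const u.dir)

theorem vel_hasDerivAt (u : UnitTangent) (s : ℝ) : HasDerivAt u.vel (u.geod s) s :=
  ((Real.hasDerivAt_sinh s).smul_const u.base).add ((Real.hasDerivAt_cosh s).smul_const u.dir)

/-- An integral curve of the ray extension that starts on `ℍ³` stays there, because the extension
is everywhere Lorentz orthogonal to the position vector. -/
theorem exists_integralCurve {V : R4 → R4} (hW : ContDiffOn ℝ ∞ (rayExt V) futureCone)
    (ht : ∀ p ∈ H3, mink p (V p) = 0) {p : R4} (hp : p ∈ H3) :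
    ∃ (c : ℝ → R4) (ε : ℝ), 0 < ε ∧ c 0 = p ∧
      ∀ t ∈ Set.Ioo (-ε) ε, c t ∈ H3 ∧ HasDerivAt c (V (c t)) t := by
  have hp' := futureCone_mem_nhds hp
  obtain ⟨r, hr, ε, hε, h⟩ :=
    ContDiffAt.exists_forall_mem_closedBall_exists_eq_forall_mem_Ioo_hasDerivAt
      ((hW.contDiffAt hp').of_le (by exact_mod_cast le_top)) 0
  obtain ⟨c, hc0, hc⟩ := h p (Metric.mem_closedBall_self hr.le)
  have hcont : ContinuousAt c 0 := (hc 0 (by constructor <;> linarith)).continuousAt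
  have hev : ∀ᶠ t in nhds (0 : ℝ), c t ∈ futureCone := hcont (by rwa [hc0])
  obtain ⟨δ, hδ, hball⟩ := Metric.eventually_nhds_iff.1 hev
  have hmem : ∀ t ∈ Set.Ioo (-min ε δ) (min ε δ), c t ∈ futureCone ∧
      HasDerivAt c (rayExt V (c t)) t := by
    intro t ht
    refine ⟨hball ?_, hc t ⟨?_, ?_⟩⟩
    · rw [Real.dist_eq, sub_zero, abs_lt]
      exact ⟨by linarith [ht.1, min_le_right ε δ], by linarith [ht.2, min_le_right ε δ]⟩
    · linarith [ht.1, min_le_left ε δ]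
    · linarith [ht.2, min_le_left ε δ]
  have hd : ∀ t ∈ Set.Ioo (-min ε δ) (min ε δ), HasDerivAt (fun t => mink (c t) (c t)) 0 t := by
    intro t hs
    obtain ⟨h1, h2⟩ := hmem t hs
    refine (h2.mink h2).congr_deriv ?_
    rw [mink_comm _ (c t), mink_rayExt ht h1, add_zero]
  have h0 : (0 : ℝ) ∈ Set.Ioo (-min ε δ) (min ε δ) := by
    have := lt_min hε hδ
    constructor <;> linarith
  refine ⟨c, min ε δ, lt_min hε hδ, hc0, fun t ht => ?_⟩
  have hH : c t ∈ H3 := by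
    refine ⟨?_, (hmem t ht).1.2⟩
    have := isOpen_Ioo.is_const_of_deriv_eq_zero isPreconnected_Ioo
      (fun s hs => (hd s hs).differentiableAt.differentiableWithinAt)
      (fun s hs => (hd s hs).deriv) ht h0
    rw [this, hc0]
    exact hp.1
  have h2 := (hmem t ht).2
  rw [rayExt_eq hH] at h2
  exact ⟨hH, h2⟩

/-- A curve with `c'' = c` on an interval around `0` is `cosh t • c(0) + sinh t • c'(0)`, because
`exp (-t) • (c + c')` and `exp t • (c - c')` are constant. -/
theorem eq_cosh_sinh_of_deriv {c d : ℝ → R4} {ε : ℝ} (hε : 0 < ε)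
    (hc : ∀ t ∈ Set.Ioo (-ε) ε, HasDerivAt c (d t) t)
    (hd : ∀ t ∈ Set.Ioo (-ε) ε, HasDerivAt d (c t) t) {t : ℝ} (ht : t ∈ Set.Ioo (-ε) ε) :
    c t = Real.cosh t • c 0 + Real.sinh t • d 0 ∧
      d t = Real.sinh t • c 0 + Real.cosh t • d 0 := by
  have h0 : (0 : ℝ) ∈ Set.Ioo (-ε) ε := ⟨by linarith, hε⟩
  have h1 : ∀ s ∈ Set.Ioo (-ε) ε,
      HasDerivAt (fun s => Real.cosh s • c s - Real.sinh s • d s) 0 s := fun s hs =>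
    (((Real.hasDerivAt_cosh s).smul (hc s hs)).sub
      ((Real.hasDerivAt_sinh s).smul (hd s hs))).congr_deriv (by abel)
  have h2 : ∀ s ∈ Set.Ioo (-ε) ε,
      HasDerivAt (fun s => Real.cosh s • d s - Real.sinh s • c s) 0 s := fun s hs =>
    (((Real.hasDerivAt_cosh s).smul (hd s hs)).sub
      ((Real.hasDerivAt_sinh s).smul (hc s hs))).congr_deriv (by abel)
  have e1 := isOpen_Ioo.is_const_of_deriv_eq_zero isPreconnected_Ioo
    (fun s hs => (h1 s hs).differentiableAt.differentiableWithinAt)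
    (fun s hs => (h1 s hs).deriv) ht h0
  have e2 := isOpen_Ioo.is_const_of_deriv_eq_zero isPreconnected_Ioo
    (fun s hs => (h2 s hs).differentiableAt.differentiableWithinAt)
    (fun s hs => (h2 s hs).deriv) ht h0
  simp only [Real.cosh_zero, Real.sinh_zero, one_smul, zero_smul, sub_zero] at e1 e2
  have hcs := Real.cosh_sq t
  rw [← e1, ← e2]
  constructor
  · ext i
    simp only [Pi.add_apply, Pi.sub_apply, Pi.smul_apply, smul_eq_mul]
    linear_combination -(c t i) * hcs
  · ext i
    simp only [Pi.add_apply, Pi.sub_apply, Pi.smul_apply, smul_eq_mul]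
    linear_combination -(d t i) * hcs

/-- Near its foot point, the geodesic tangent to `V` is an integral curve of `V`. -/
theorem IsGeodesicFoliation.eventually_vel_eq {V : R4 → R4} (hV : IsGeodesicFoliation V)
    {u : UnitTangent} (hu : u.dir = V u.base) :
    ∀ᶠ t in nhds (0 : ℝ), u.vel t = V (u.geod t) := by
  have hW := contDiffOn_rayExt hV.smooth
  obtain ⟨c, ε, hε, hc0, hc⟩ := exists_integralCurve hW hV.tangent u.base_mem
  have hderiv : ∀ t ∈ Set.Ioo (-ε) ε, deriv c t = V (c t) := fun t ht => (hc t ht).2.deriv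
  have hc2 : ∀ t ∈ Set.Ioo (-ε) ε, HasDerivAt (deriv c) (c t) t := by
    intro t ht
    have hnhds : Set.Ioo (-ε) ε ∈ nhds t := isOpen_Ioo.mem_nhds ht
    have hWd : DifferentiableAt ℝ (rayExt V) (c t) :=
      (hW.contDiffAt (futureCone_mem_nhds (hc t ht).1)).differentiableAt (by simp)
    have hdiff : DifferentiableAt ℝ (deriv c) t := by
      refine (hWd.comp t (hc t ht).2.differentiableAt).congr_of_eventuallyEq ?_
      filter_upwards [hnhds] with s hs
      rw [hderiv s hs, Function.comp, rayExt_eq (hc s hs).1]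
    have hcov := hV.geodesic c (-ε) ε hc t ht
    have hcc : mink (c t) (deriv (deriv c) t) = -1 := by
      have h1 := (hc t ht).2.mink hdiff.hasDerivAt
      have h2 : HasDerivAt (fun t => mink (c t) (deriv c t)) 0 t := by
        refine (hasDerivAt_const t (0 : ℝ)).congr_of_eventuallyEq ?_
        filter_upwards [hnhds] with s hs
        rw [hderiv s hs, hV.tangent _ (hc s hs).1]
      have h3 := h1.unique h2
      rw [hderiv t ht, hV.unit _ (hc t ht).1] at h3
      linarith
    rw [covDerivAlong, tproj, hcc, neg_one_smul, ← sub_eq_add_neg, sub_eq_zero] at hcov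
    rw [← hcov]
    exact hdiff.hasDerivAt
  have h0 : (0 : ℝ) ∈ Set.Ioo (-ε) ε := ⟨by linarith, hε⟩
  filter_upwards [isOpen_Ioo.mem_nhds h0] with t ht
  have hcd : ∀ t ∈ Set.Ioo (-ε) ε, HasDerivAt c (deriv c t) t := fun t ht =>
    (hc t ht).2.differentiableAt.hasDerivAt
  obtain ⟨h1, h2⟩ := eq_cosh_sinh_of_deriv hε hcd hc2 ht
  rw [hderiv t ht, hderiv 0 h0, hc0, ← hu] at h2
  rw [hderiv 0 h0, hc0, ← hu] at h1
  rw [UnitTangent.vel, UnitTangent.geod, ← h2, ← h1]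

theorem continuous_comp_geod {V : R4 → R4} (hW : ContDiffOn ℝ ∞ (rayExt V) futureCone)
    (u : UnitTangent) : Continuous fun t => V (u.geod t) := by
  have hg : Continuous u.geod :=
    continuous_iff_continuousAt.2 fun t => (geod_hasDerivAt u t).continuousAt
  have h := hW.continuousOn.comp_continuous hg
    fun t => H3_subset_futureCone (u.flow t).base_mem
  refine h.congr fun t => ?_
  exact rayExt_eq (u.flow t).base_mem

/-- Integral curves that are geodesics extend to complete geodesics: the set of times at which
the geodesic is tangent to `V` is closed, open and not empty. -/
theorem IsGeodesicFoliation.isLeafField {V : R4 → R4} (hV : IsGeodesicFoliation V) :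
    IsLeafField V where
  smooth := contDiffOn_rayExt hV.smooth
  tangent := hV.tangent
  unit := hV.unit
  flow := by
    intro u hu
    have hcl : IsClosed {t | u.vel t = V (u.geod t)} :=
      isClosed_eq (continuous_iff_continuousAt.2 fun t => (vel_hasDerivAt u t).continuousAt)
        (continuous_comp_geod (contDiffOn_rayExt hV.smooth) u)
    have hop : IsOpen {t | u.vel t = V (u.geod t)} := by
      rw [isOpen_iff_mem_nhds]
      intro t ht
      have h := IsGeodesicFoliation.eventually_vel_eq hV (u := u.flow t) ht
      have hs : Filter.Tendsto (fun s => s - t) (nhds t) (nhds 0) := by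
        have : Continuous fun s : ℝ => s - t := by fun_prop
        simpa using this.tendsto t
      filter_upwards [hs.eventually h] with s hs
      have e := u.flow_flow (s - t) t
      rw [sub_add_cancel] at e
      have e1 : (u.flow t).vel (s - t) = u.vel s := congrArg UnitTangent.dir e
      have e2 : (u.flow t).geod (s - t) = u.geod s := congrArg UnitTangent.base e
      rwa [e1, e2] at hs
    have hun := IsClopen.eq_univ ⟨hcl, hop⟩ ⟨0, by
      change u.vel 0 = V (u.geod 0)
      simp [UnitTangent.vel, UnitTangent.geod, hu]⟩
    exact fun t => (Set.eq_univ_iff_forall.1 hun t :)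

/-! ### The derivative of the vector field -/

theorem hasDerivAt_rayExt_comp {V : R4 → R4} (h : IsLeafField V) {c : ℝ → R4} {a p : R4} {t : ℝ}
    (hc : HasDerivAt c a t) (hp : c t = p) (hpH : p ∈ H3) :
    HasDerivAt (fun s => rayExt V (c s)) (fderiv ℝ (rayExt V) p a) t := by
  subst hp
  have hd : DifferentiableAt ℝ (rayExt V) (c t) :=
    (h.smooth.contDiffAt (futureCone_mem_nhds hpH)).differentiableAt (by simp)
  exact hd.hasFDerivAt.comp_hasDerivAt t hc

theorem hasDerivAt_line (p u : R4) : HasDerivAt (fun t : ℝ => p + t • u) u 0 := by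
  simpa using ((hasDerivAt_id (0 : ℝ)).smul_const u).const_add p

theorem eventually_line_mem {p : R4} (hp : p ∈ H3) (u : R4) :
    ∀ᶠ t in nhds (0 : ℝ), p + t • u ∈ futureCone :=
  (hasDerivAt_line p u).continuousAt (by simpa using futureCone_mem_nhds hp)

theorem IsLeafField.mink_fderiv {V : R4 → R4} (h : IsLeafField V) {p : R4} (hp : p ∈ H3) (u : R4) :
    mink (V p) (fderiv ℝ (rayExt V) p u) = 0 := by
  have h1 := hasDerivAt_rayExt_comp h (hasDerivAt_line p u) (by simp) hp
  have h2 := h1.mink h1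
  have h3 : HasDerivAt (fun t : ℝ => mink (rayExt V (p + t • u)) (rayExt V (p + t • u))) 0 0 := by
    refine (hasDerivAt_const (0 : ℝ) (1 : ℝ)).congr_of_eventuallyEq ?_
    filter_upwards [eventually_line_mem hp u] with t ht
    exact h.unit _ (radialProj_mem ht)
  have h4 := h2.unique h3
  simp only [zero_smul, add_zero, rayExt_eq hp] at h4
  rw [mink_comm _ (V p)] at h4
  linarith

theorem IsLeafField.mink_base_fderiv {V : R4 → R4} (h : IsLeafField V) {p : R4} (hp : p ∈ H3)
    (u : R4) : mink p (fderiv ℝ (rayExt V) p u) = -mink (V p) u := by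
  have h1 := hasDerivAt_rayExt_comp h (hasDerivAt_line p u) (by simp) hp
  have h2 := (hasDerivAt_line p u).mink h1
  have h3 : HasDerivAt (fun t : ℝ => mink (p + t • u) (rayExt V (p + t • u))) 0 0 := by
    refine (hasDerivAt_const (0 : ℝ) (0 : ℝ)).congr_of_eventuallyEq ?_
    filter_upwards [eventually_line_mem hp u] with t ht
    exact mink_rayExt h.tangent ht
  have h4 := h2.unique h3
  simp only [zero_smul, add_zero, rayExt_eq hp] at h4
  rw [mink_comm (V p) u]
  linarith

/-- The value of a leaf field at a point of `ℍ³`, as a unit tangent vector. -/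
def IsLeafField.vec {V : R4 → R4} (h : IsLeafField V) {p : R4} (hp : p ∈ H3) : UnitTangent :=
  ⟨p, V p, hp, h.tangent p hp, h.unit p hp⟩

/-- The integral curves of the field are geodesics, `∇_V V = 0`; in the ambient space the
acceleration of a geodesic of the hyperboloid is its position. -/
theorem IsLeafField.fderiv_self {V : R4 → R4} (h : IsLeafField V) {p : R4} (hp : p ∈ H3) :
    fderiv ℝ (rayExt V) p (V p) = p := by
  have h1 := hasDerivAt_rayExt_comp h (geod_hasDerivAt (h.vec hp) 0)
    (p := p) (by simp [UnitTangent.geod, IsLeafField.vec]) hp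
  have h2 : HasDerivAt (fun s => rayExt V ((h.vec hp).geod s)) ((h.vec hp).geod 0) 0 := by
    refine (vel_hasDerivAt (h.vec hp) 0).congr_of_eventuallyEq (Filter.Eventually.of_forall ?_)
    intro s
    exact (rayExt_eq ((h.vec hp).flow s).base_mem).trans (h.flow _ rfl s).symm
  have h3 := h1.unique h2
  simpa [UnitTangent.geod, UnitTangent.vel, IsLeafField.vec] using h3

theorem IsLeafField.covDeriv_eq {V : R4 → R4} (h : IsLeafField V) {p a : R4} (hp : p ∈ H3)
    (ha : mink (V p) a = 0) : covDeriv V p a = fderiv ℝ (rayExt V) p a := by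
  change tproj p (fderiv ℝ (rayExt V) p a) = _
  rw [tproj, h.mink_base_fderiv hp, ha, neg_zero, zero_smul, add_zero]

/-- A smooth curve in `ℍ³` with initial velocity `a ∈ T_p ℍ³`. -/
noncomputable def tangentCurve (p a : R4) (t : ℝ) : R4 :=
  Real.sqrt (1 + t ^ 2 * mink a a) • p + t • a

@[simp] theorem tangentCurve_zero (p a : R4) : tangentCurve p a 0 = p := by simp [tangentCurve]

theorem one_add_sq_mul_pos {p a : R4} (hp : p ∈ H3) (ha : mink p a = 0) (t : ℝ) :
    0 < 1 + t ^ 2 * mink a a := by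
  have := mul_nonneg (sq_nonneg t) (mink_self_nonneg hp ha)
  linarith

theorem tangentCurve_mem {p a : R4} (hp : p ∈ H3) (ha : mink p a = 0) (t : ℝ) :
    tangentCurve p a t ∈ H3 := by
  have h0 := one_add_sq_mul_pos hp ha t
  have h1 := Real.sq_sqrt h0.le
  have h2 := Real.sqrt_pos.2 h0
  have e : mink (tangentCurve p a t) (tangentCurve p a t) = -1 := by
    simp only [tangentCurve, mink_add_left, mink_add_right, mink_smul_left, mink_smul_right, hp.1,
      mink_comm a p, ha]
    linear_combination -h1
  refine ⟨e, zero_lt_of_mink_neg hp (by linarith) ?_⟩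
  simp only [tangentCurve, mink_add_left, mink_smul_left, hp.1, mink_comm a p, ha]
  linarith

theorem contDiff_tangentCurve {p a : R4} (hp : p ∈ H3) (ha : mink p a = 0) :
    ContDiff ℝ ∞ (tangentCurve p a) := by
  have h1 : ContDiff ℝ ∞ fun t : ℝ => 1 + t ^ 2 * mink a a := by fun_prop
  exact ((h1.sqrt fun t => (one_add_sq_mul_pos hp ha t).ne').smul contDiff_const).add
    (contDiff_id.smul contDiff_const)

theorem hasDerivAt_tangentCurve (p a : R4) : HasDerivAt (tangentCurve p a) a 0 := by
  have h1 : HasDerivAt (fun t : ℝ => 1 + t ^ 2 * mink a a) 0 0 := by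
    simpa using (((hasDerivAt_id (0 : ℝ)).pow 2).mul_const (mink a a)).const_add 1
  have h2 := ((h1.sqrt (by simp)).smul_const p).add ((hasDerivAt_id (0 : ℝ)).smul_const a)
  exact h2.congr_deriv (by simp)

/-- The Jacobi field `cosh s • a + sinh s • ∇_a V` of a variation through leaves evolves by the
derivative of `V`. -/
theorem IsLeafField.fderiv_flow {V : R4 → R4} (h : IsLeafField V) {p a : R4} (hp : p ∈ H3)
    (ha : mink p a = 0) (s : ℝ) :
    fderiv ℝ (rayExt V) ((h.vec hp).geod s)
      (Real.cosh s • a + Real.sinh s • fderiv ℝ (rayExt V) p a)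
      = Real.sinh s • a + Real.cosh s • fderiv ℝ (rayExt V) p a := by
  have hc := hasDerivAt_tangentCurve p a
  have hW := hasDerivAt_rayExt_comp h hc (tangentCurve_zero p a) hp
  have hg := (hc.const_smul (Real.cosh s)).add (hW.const_smul (Real.sinh s))
  have hv := (hc.const_smul (Real.sinh s)).add (hW.const_smul (Real.cosh s))
  have h1 := hasDerivAt_rayExt_comp h hg (p := (h.vec hp).geod s)
    (by simp [UnitTangent.geod, IsLeafField.vec, rayExt_eq hp]) ((h.vec hp).flow s).base_mem
  refine h1.unique (hv.congr_of_eventuallyEq (Filter.Eventually.of_forall fun t => ?_))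
  have hm := tangentCurve_mem hp ha t
  have hf := h.flow (h.vec hm) rfl s
  have hr := rayExt_eq (V := V) ((h.vec hm).flow s).base_mem
  simp only [UnitTangent.flow, UnitTangent.geod, UnitTangent.vel, IsLeafField.vec] at hf hr
  simp only [Pi.add_apply, Pi.smul_apply, rayExt_eq hm]
  exact hr.trans hf.symm

/-- Along a complete geodesic the Jacobi field `(cosh s + k sinh s) a` of an eigenvector with
eigenvalue `|k| > 1` would vanish at some time, but not its derivative. -/
theorem IsLeafField.sq_eigenvalue_le_one {V : R4 → R4} (h : IsLeafField V) {p a : R4} (hp : p ∈ H3)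
    (ha : mink p a = 0) (ha0 : a ≠ 0) {k : ℝ} (hk : fderiv ℝ (rayExt V) p a = k • a) :
    k ^ 2 ≤ 1 := by
  by_contra! hk1
  -- The zero of `cosh s + k sinh s` is the solution of `exp (2 * s) = (k - 1) / (k + 1)`.
  have hpos : 0 < (k - 1) / (k + 1) := by
    have e : (k - 1) / (k + 1) = (k ^ 2 - 1) / (k + 1) ^ 2 := by
      have : k + 1 ≠ 0 := by rintro h0; nlinarith
      field_simp
      ring
    rw [e]
    have : k + 1 ≠ 0 := by rintro h0; nlinarith
    exact div_pos (by linarith) (by positivity)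
  obtain ⟨s, hs⟩ : ∃ s : ℝ, Real.exp s * Real.exp s * (k + 1) = k - 1 := by
    refine ⟨Real.log ((k - 1) / (k + 1)) / 2, ?_⟩
    have : k + 1 ≠ 0 := by rintro h0; nlinarith
    rw [← Real.exp_add, add_halves, Real.exp_log hpos, div_mul_cancel₀ _ this]
  have he : Real.exp s * Real.exp (-s) = 1 := by rw [← Real.exp_add]; simp
  have h0 : Real.cosh s + k * Real.sinh s = 0 := by
    have h2 : Real.exp s * (Real.cosh s + k * Real.sinh s) = 0 := by
      rw [Real.cosh_eq, Real.sinh_eq]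
      linear_combination (1 / 2 : ℝ) * hs + (1 - k) / 2 * he
    exact (mul_eq_zero.1 h2).resolve_left (Real.exp_pos s).ne'
  have hf := h.fderiv_flow hp ha s
  rw [hk, smul_smul, smul_smul, ← add_smul, ← add_smul, mul_comm _ k, h0, zero_smul, map_zero] at hf
  have h1 := (smul_eq_zero.1 hf.symm).resolve_right ha0
  have hcs := Real.cosh_sq s
  exact one_ne_zero (α := ℝ) (by linear_combination Real.cosh s * h0 - Real.sinh s * h1 - hcs)

/-! ### Recovering unit vectors from the Plücker embedding -/

/-- Contraction of a bivector with a vector by means of the Lorentz form. -/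
def contract (B : Fin 4 → Fin 4 → ℝ) (x : R4) : R4 := fun i => mink (B i) x

theorem contract_wedge (x y w : R4) :
    contract (wedge x y) w = mink y w • x - mink x w • y := by
  funext i
  simp only [contract, mink, wedge, Pi.sub_apply, Pi.smul_apply, smul_eq_mul]
  ring

theorem contract_add (A B : Fin 4 → Fin 4 → ℝ) (x : R4) :
    contract (A + B) x = contract A x + contract B x := by
  funext i
  exact mink_add_left (A i) (B i) x

theorem _root_.ContDiff.contract {E : Type*} [NormedAddCommGroup E] [NormedSpace ℝ E]
    {n : WithTop ℕ∞} {B : E → Fin 4 → Fin 4 → ℝ} {x : E → R4} (hB : ContDiff ℝ n B)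
    (hx : ContDiff ℝ n x) : ContDiff ℝ n fun t => contract (B t) (x t) :=
  contDiff_pi.2 fun i => (contDiff_pi.1 hB i).mink hx

theorem _root_.ContDiff.wedge {E : Type*} [NormedAddCommGroup E] [NormedSpace ℝ E]
    {n : WithTop ℕ∞} {x y : E → R4} (hx : ContDiff ℝ n x) (hy : ContDiff ℝ n y) :
    ContDiff ℝ n fun t => wedge (x t) (y t) :=
  contDiff_pi.2 fun i => contDiff_pi.2 fun j =>
    ((contDiff_pi.1 hx i).mul (contDiff_pi.1 hy j)).sub
      ((contDiff_pi.1 hy i).mul (contDiff_pi.1 hx j))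

theorem _root_.HasDerivAt.wedge {c d : ℝ → R4} {c' d' : R4} {t : ℝ} (hc : HasDerivAt c c' t)
    (hd : HasDerivAt d d' t) :
    HasDerivAt (fun s => wedge (c s) (d s)) (wedge c' (d t) + wedge (c t) d') t := by
  have b := hasDerivAt_pi.1 hc
  have e := hasDerivAt_pi.1 hd
  refine hasDerivAt_pi.2 fun i => hasDerivAt_pi.2 fun j => ?_
  refine (((b i).mul (e j)).sub ((e i).mul (b j))).congr_deriv ?_
  simp only [HypFoliation.wedge, Pi.add_apply]
  ring

/-- For the bivector of an oriented geodesic, a positive multiple of the sum of the two null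
vectors with `0`-th coordinate `1` that represent its endpoints. -/
def axisSum (B : Fin 4 → Fin 4 → ℝ) : R4 := contract B (contract B origin)

/-- For the bivector of an oriented geodesic, a null vector in the direction of its forward
endpoint, with the same normalization as in `axisSum`. -/
def forwardNull (B : Fin 4 → Fin 4 → ℝ) : R4 := axisSum B + contract B origin

/-- For the bivector of an oriented geodesic, a null vector in the direction of its backward
endpoint, with the same normalization as in `axisSum`. -/
def backwardNull (B : Fin 4 → Fin 4 → ℝ) : R4 := axisSum B - contract B origin

/-- The point `p` of an oriented geodesic, given by its bivector, at which the unit tangent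
vector `v` satisfies `p 0 + v 0 = c`. -/
noncomputable def footPoint (c : ℝ) (B : Fin 4 → Fin 4 → ℝ) : R4 :=
  (c / 2 * (axisSum B 0)⁻¹) • forwardNull B + (2 * c)⁻¹ • backwardNull B

theorem contDiff_axisSum : ContDiff ℝ ∞ axisSum :=
  contDiff_id.contract (contDiff_id.contract contDiff_const)

theorem contDiff_forwardNull : ContDiff ℝ ∞ forwardNull :=
  contDiff_axisSum.add (contDiff_id.contract contDiff_const)

theorem contDiff_backwardNull : ContDiff ℝ ∞ backwardNull :=
  contDiff_axisSum.sub (contDiff_id.contract contDiff_const)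

theorem contDiffAt_footPoint (c : ℝ) {B : Fin 4 → Fin 4 → ℝ} (hB : axisSum B 0 ≠ 0) :
    ContDiffAt ℝ ∞ (footPoint c) B := by
  have h1 : ContDiffAt ℝ ∞ (fun B => axisSum B 0) B := (contDiff_pi.1 contDiff_axisSum 0).contDiffAt
  exact ((contDiffAt_const.mul (h1.inv hB)).smul contDiff_forwardNull.contDiffAt).add
    (contDiff_backwardNull.contDiffAt.const_smul _)

theorem mink_origin (x : R4) : mink x origin = -x 0 := by
  simp [mink, origin]

theorem plucker_line (u : UnitTangent) : plucker u.line = wedge u.base u.dir := rfl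

theorem IsLeafField.plucker_vec {V : R4 → R4} (h : IsLeafField V) {p : R4} (hp : p ∈ H3) :
    plucker (h.vec hp).line = wedge p (rayExt V p) := by
  rw [rayExt_eq hp]
  rfl

theorem axisSum_plucker (u : UnitTangent) :
    axisSum (plucker u.line) = u.base 0 • u.base - u.dir 0 • u.dir := by
  have h := u.base_mem.1
  rw [plucker_line, axisSum, contract_wedge, contract_wedge]
  simp only [mink_sub_right, mink_smul_right, mink_origin, h, u.orth, u.unit,
    mink_comm u.dir u.base]
  module

theorem contract_plucker_origin (u : UnitTangent) :
    contract (plucker u.line) origin = u.base 0 • u.dir - u.dir 0 • u.base := by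
  rw [plucker_line, contract_wedge]
  simp only [mink_origin]
  module

theorem forwardNull_plucker (u : UnitTangent) :
    forwardNull (plucker u.line) = (u.base 0 - u.dir 0) • (u.base + u.dir) := by
  rw [forwardNull, axisSum_plucker, contract_plucker_origin]
  module

theorem backwardNull_plucker (u : UnitTangent) :
    backwardNull (plucker u.line) = (u.base 0 + u.dir 0) • (u.base - u.dir) := by
  rw [backwardNull, axisSum_plucker, contract_plucker_origin]
  module

theorem nullDiff_pos (u : UnitTangent) : 0 < u.base 0 - u.dir 0 := by
  linarith [abs_lt.1 u.abs_dir_lt]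

theorem axisSum_plucker_zero (u : UnitTangent) :
    axisSum (plucker u.line) 0 = (u.base 0 - u.dir 0) * (u.base 0 + u.dir 0) := by
  rw [axisSum_plucker]
  simp only [Pi.sub_apply, Pi.smul_apply, smul_eq_mul]
  ring

theorem axisSum_plucker_pos (u : UnitTangent) : 0 < axisSum (plucker u.line) 0 := by
  rw [axisSum_plucker_zero]
  exact mul_pos (nullDiff_pos u) (nullSum_pos u)

theorem footPoint_plucker (u : UnitTangent) :
    footPoint (u.base 0 + u.dir 0) (plucker u.line) = u.base := by
  have h1 := (nullSum_pos u).ne'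
  have h2 := (nullDiff_pos u).ne'
  rw [footPoint, axisSum_plucker_zero, forwardNull_plucker, backwardNull_plucker, smul_smul,
    smul_smul]
  have e1 : (u.base 0 + u.dir 0) / 2 * ((u.base 0 - u.dir 0) * (u.base 0 + u.dir 0))⁻¹
      * (u.base 0 - u.dir 0) = 1 / 2 := by field_simp
  have e2 : (2 * (u.base 0 + u.dir 0))⁻¹ * (u.base 0 + u.dir 0) = 1 / 2 := by field_simp
  rw [e1, e2]
  module

theorem line_flow (u : UnitTangent) (t : ℝ) : (u.flow t).line = u.line :=
  (Quotient.sound ⟨t, rfl⟩ : u.line = (u.flow t).line).symm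

/-- The null vector `γ + γ̇` grows like `exp t`, so every positive normalization of it occurs. -/
theorem exists_line_eq (ℓ : OrientedGeodesic) {c : ℝ} (hc : 0 < c) :
    ∃ u : UnitTangent, u.line = ℓ ∧ u.base 0 + u.dir 0 = c ∧ u.base = footPoint c (plucker ℓ) := by
  obtain ⟨w, rfl⟩ := Quotient.exists_rep ℓ
  have hw := nullSum_pos w
  set t := Real.log (c / (w.base 0 + w.dir 0)) with ht
  have hN : (w.flow t).base 0 + (w.flow t).dir 0 = c := by
    have e : (w.flow t).base 0 + (w.flow t).dir 0 = Real.exp t * (w.base 0 + w.dir 0) := by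
      simp only [UnitTangent.flow, UnitTangent.geod, UnitTangent.vel, ← Real.cosh_add_sinh,
        Pi.add_apply, Pi.smul_apply, smul_eq_mul]
      ring
    rw [e, ht, Real.exp_log (div_pos hc hw), div_mul_cancel₀ _ hw.ne']
  refine ⟨w.flow t, line_flow w t, hN, ?_⟩
  have h := footPoint_plucker (w.flow t)
  rw [hN, line_flow] at h
  exact h.symm

/-! ### The tangent spaces of the space of leaves -/

theorem IsLeafField.line_mem_iff {V : R4 → R4} (h : IsLeafField V) {u : UnitTangent} :
    u.line ∈ leafSpace V ↔ u.dir = V u.base := by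
  refine ⟨?_, fun hu => ⟨u, hu, rfl⟩⟩
  rintro ⟨w, hw, he⟩
  obtain ⟨t, rfl⟩ := Quotient.exact he
  exact h.flow w hw t

theorem IsLeafField.vec_line_mem {V : R4 → R4} (h : IsLeafField V) {p : R4} (hp : p ∈ H3) :
    (h.vec hp).line ∈ leafSpace V := ⟨h.vec hp, rfl, rfl⟩

/-- A normal Jacobi field with initial values `a` and `b` is tangent to the space of leaves if and
only if `b = ∇_a V`. -/
theorem IsLeafField.mem_tangentSet_iff {V : R4 → R4} (h : IsLeafField V) {p a b : R4} (hp : p ∈ H3)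
    (hpa : mink p a = 0) (hva : mink (V p) a = 0) (hpb : mink p b = 0) (hvb : mink (V p) b = 0) :
    wedge a (V p) + wedge p b ∈ tangentSet plucker (leafSpace V) (h.vec hp).line ↔
      b = fderiv ℝ (rayExt V) p a := by
  constructor
  · rintro ⟨c, ε, hε, hc0, hcM, hcs, hcd⟩
    set k := (h.vec hp).base 0 + (h.vec hp).dir 0 with hk
    have hk0 : 0 < k := nullSum_pos (h.vec hp)
    -- The feet of the leaves `c t` form a smooth curve in `ℍ³`.
    set q : ℝ → R4 := fun t => footPoint k (plucker (c t)) with hq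
    have hfd : DifferentiableAt ℝ (footPoint k) (plucker (c 0)) :=
      (contDiffAt_footPoint k (by rw [hc0]; exact (axisSum_plucker_pos _).ne')).differentiableAt
        (by simp)
    obtain ⟨a', hqd⟩ : ∃ a', HasDerivAt q a' 0 := by
      refine ⟨fderiv ℝ (footPoint k) (plucker (c 0)) (wedge a (V p) + wedge p b), ?_⟩
      exact hfd.hasFDerivAt.comp_hasDerivAt (0 : ℝ) hcd
    have hq0 : q 0 = p := by
      simp only [hq, hc0]
      exact footPoint_plucker (h.vec hp)
    have h0 : (0 : ℝ) ∈ Set.Ioo (-ε) ε := ⟨by linarith, hε⟩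
    have hlift : ∀ t ∈ Set.Ioo (-ε) ε, q t ∈ H3 ∧ plucker (c t) = wedge (q t) (rayExt V (q t)) := by
      intro t ht
      obtain ⟨w, hw1, -, hw2⟩ := exists_line_eq (c t) hk0
      have hwM : w.dir = V w.base := h.line_mem_iff.1 (by rw [hw1]; exact hcM t ht)
      have hqw : q t = w.base := hw2.symm
      rw [hqw, rayExt_eq w.base_mem, ← hwM, ← hw1]
      exact ⟨w.base_mem, rfl⟩
    have hpa' : mink p a' = 0 := by
      have h1 := hqd.mink hqd
      have h2 : HasDerivAt (fun t => mink (q t) (q t)) 0 0 := by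
        refine (hasDerivAt_const (0 : ℝ) (-1 : ℝ)).congr_of_eventuallyEq ?_
        filter_upwards [isOpen_Ioo.mem_nhds h0] with t ht
        exact (hlift t ht).1.1
      have h3 := h1.unique h2
      rw [hq0, mink_comm a' p] at h3
      linarith
    have hX : wedge a (V p) + wedge p b
        = wedge a' (V p) + wedge p (fderiv ℝ (rayExt V) p a') := by
      have h1 := hqd.wedge (hasDerivAt_rayExt_comp h hqd hq0 hp)
      rw [hq0, rayExt_eq hp] at h1
      refine hcd.unique (h1.congr_of_eventuallyEq ?_)
      filter_upwards [isOpen_Ioo.mem_nhds h0] with t ht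
      exact (hlift t ht).2
    have hpv := h.tangent p hp
    have hvv := h.unit p hp
    have hDv := h.mink_fderiv hp a'
    have hDp := h.mink_base_fderiv hp a'
    -- Contraction with `V p` and with `p` recovers the two initial values.
    have e1 := congrArg (contract · (V p)) hX
    have e2 := congrArg (contract · p) hX
    simp only [contract_add, contract_wedge, mink_comm _ p, hpv, hvv, hp.1, hpa, hpb, hpa',
      mink_comm _ (V p), hva, hvb, hDv, hDp] at e1 e2
    have e3 : a = a' - mink (V p) a' • V p := by
      simpa using e1
    have e4 : b = fderiv ℝ (rayExt V) p a' - mink (V p) a' • p := by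
      simpa [sub_eq_add_neg, add_comm] using e2
    rw [e4, e3, map_sub, map_smul, h.fderiv_self hp]
  · rintro rfl
    have hm := fun t => tangentCurve_mem hp hpa t
    have hW : ContDiff ℝ ∞ fun t => rayExt V (tangentCurve p a t) :=
      contDiffOn_univ.1 (h.smooth.comp (contDiff_tangentCurve hp hpa).contDiffOn
        fun t _ => H3_subset_futureCone (hm t))
    have he : (fun t => plucker (h.vec (hm t)).line)
        = fun t => wedge (tangentCurve p a t) (rayExt V (tangentCurve p a t)) :=
      funext fun t => h.plucker_vec (hm t)
    refine ⟨fun t => (h.vec (hm t)).line, 1, one_pos, ?_, fun t _ => h.vec_line_mem (hm t), ?_, ?_⟩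
    · exact congrArg UnitTangent.line
        (UnitTangent.ext (tangentCurve_zero p a) (congrArg V (tangentCurve_zero p a)))
    · rw [he]
      exact ((contDiff_tangentCurve hp hpa).wedge hW).contDiffOn
    · rw [he]
      have hc := hasDerivAt_tangentCurve p a
      have := hc.wedge (hasDerivAt_rayExt_comp h hc (tangentCurve_zero p a) hp)
      simpa [rayExt_eq hp] using this

/-- The initial values of a normal Jacobi field lie in the normal plane. -/
theorem IsNormalJacobi.initial {u : UnitTangent} {J : ℝ → R4} (hJ : IsNormalJacobi u J) :
    mink u.base (J 0) = 0 ∧ mink u.dir (J 0) = 0 ∧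
      mink u.base (covDerivAlong u.geod J 0) = 0 ∧ mink u.dir (covDerivAlong u.geod J 0) = 0 := by
  have g0 : u.geod 0 = u.base := by simp [UnitTangent.geod]
  have v0 : u.vel 0 = u.dir := by simp [UnitTangent.vel]
  have hd : HasDerivAt J (deriv J 0) 0 := (hJ.smooth.differentiable (by simp) 0).hasDerivAt
  have h1 := hJ.tangent 0
  have h2 := hJ.orth 0
  have h3 := ((geod_hasDerivAt u 0).mink hd).unique
    ((hasDerivAt_const (0 : ℝ) (0 : ℝ)).congr_of_eventuallyEq (.of_forall hJ.tangent))
  have h4 := ((vel_hasDerivAt u 0).mink hd).unique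
    ((hasDerivAt_const (0 : ℝ) (0 : ℝ)).congr_of_eventuallyEq (.of_forall hJ.orth))
  rw [g0] at h1
  rw [v0] at h2
  rw [v0, g0, h2, zero_add] at h3
  rw [v0, g0, h1, zero_add] at h4
  have e : covDerivAlong u.geod J 0 = deriv J 0 := by
    rw [covDerivAlong, tproj, g0, h3, zero_smul, add_zero]
  rw [e]
  exact ⟨h1, h2, h3, h4⟩

/-- In the hyperboloid model the normal Jacobi fields are `cosh s • a + sinh s • b`. -/
theorem exists_isNormalJacobi {u : UnitTangent} {a b : R4} (hpa : mink u.base a = 0)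
    (hva : mink u.dir a = 0) (hpb : mink u.base b = 0) (hvb : mink u.dir b = 0) :
    ∃ J, IsNormalJacobi u J ∧ J 0 = a ∧ covDerivAlong u.geod J 0 = b := by
  set J : ℝ → R4 := fun s => Real.cosh s • a + Real.sinh s • b with hJ
  set K : ℝ → R4 := fun s => Real.sinh s • a + Real.cosh s • b with hK
  have hJd : ∀ s, HasDerivAt J (K s) s := fun s =>
    ((Real.hasDerivAt_cosh s).smul_const a).add ((Real.hasDerivAt_sinh s).smul_const b)
  have hKd : ∀ s, HasDerivAt K (J s) s := fun s =>
    ((Real.hasDerivAt_sinh s).smul_const a).add ((Real.hasDerivAt_cosh s).smul_const b)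
  have gJ : ∀ s, mink (u.geod s) (J s) = 0 := fun s => by
    simp only [hJ, UnitTangent.geod, mink_add_left, mink_add_right, mink_smul_left,
      mink_smul_right, hpa, hva, hpb, hvb]
    ring
  have gK : ∀ s, mink (u.geod s) (K s) = 0 := fun s => by
    simp only [hK, UnitTangent.geod, mink_add_left, mink_add_right, mink_smul_left,
      mink_smul_right, hpa, hva, hpb, hvb]
    ring
  have vJ : ∀ s, mink (u.vel s) (J s) = 0 := fun s => by
    simp only [hJ, UnitTangent.vel, mink_add_left, mink_add_right, mink_smul_left,
      mink_smul_right, hpa, hva, hpb, hvb]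
    ring
  have cJ : covDerivAlong u.geod J = K := by
    funext s
    rw [covDerivAlong, (hJd s).deriv, tproj, gK, zero_smul, add_zero]
  have cK : covDerivAlong u.geod K = J := by
    funext s
    rw [covDerivAlong, (hKd s).deriv, tproj, gJ, zero_smul, add_zero]
  refine ⟨J, ⟨?_, gJ, vJ, fun s => ?_⟩, by simp [hJ], by rw [cJ]; simp [hK]⟩
  · exact (Real.contDiff_cosh.smul contDiff_const).add (Real.contDiff_sinh.smul contDiff_const)
  · have huu : mink (u.vel s) (u.vel s) = 1 := (u.flow s).unit
    rw [cJ, cK, curv, huu, mink_comm, vJ]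
    simp

/-- A property of the nonzero tangent vectors of the space of leaves is a property of the pairs
`(a, ∇_a V)` with `a ≠ 0` normal to the field. -/
theorem IsLeafField.forall_tangent_iff {V : R4 → R4} (h : IsLeafField V)
    (P : R4 → R4 → R4 → R4 → Prop) :
    (∀ (u : UnitTangent) (J : ℝ → R4), u.line ∈ leafSpace V → IsNormalJacobi u J →
      jacobiToTangent u J ∈ tangentSet plucker (leafSpace V) u.line → jacobiToTangent u J ≠ 0 →
      P u.base u.dir (J 0) (covDerivAlong u.geod J 0)) ↔
    ∀ p ∈ H3, ∀ a, mink p a = 0 → mink (V p) a = 0 → a ≠ 0 →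
      P p (V p) a (fderiv ℝ (rayExt V) p a) := by
  constructor
  · intro H p hp a hpa hva ha
    have hpD : mink p (fderiv ℝ (rayExt V) p a) = 0 := by
      rw [h.mink_base_fderiv hp, hva, neg_zero]
    obtain ⟨J, hJ, h0, h1⟩ := exists_isNormalJacobi (u := h.vec hp) hpa hva hpD (h.mink_fderiv hp a)
    have hT : jacobiToTangent (h.vec hp) J = wedge a (V p) + wedge p (fderiv ℝ (rayExt V) p a) := by
      rw [jacobiToTangent, h0, h1]
      rfl
    have key := H (h.vec hp) J (h.vec_line_mem hp) hJ
      (by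
        rw [hT]
        exact (h.mem_tangentSet_iff hp hpa hva hpD (h.mink_fderiv hp a)).2 rfl)
      (by
        rw [hT]
        intro hz
        have e := congrArg (contract · (V p)) hz
        simp only [contract_add, contract_wedge, h.tangent p hp, h.unit p hp, mink_comm _ (V p),
          hva, h.mink_fderiv hp a] at e
        apply ha
        simpa [contract, funext_iff] using e)
    rwa [h0, h1] at key
  · intro H u J hu hJ hT hne
    obtain ⟨h1, h2, h3, h4⟩ := hJ.initial
    have hdir := h.line_mem_iff.1 hu
    have hvec : h.vec u.base_mem = u := by ext1 <;> simp [IsLeafField.vec, hdir]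
    rw [hdir] at h2 h4
    rw [jacobiToTangent, hdir] at hT hne
    have hb := (h.mem_tangentSet_iff u.base_mem h1 h2 h3 h4).1 (by rwa [hvec])
    rw [hb, hdir]
    refine H _ u.base_mem _ h1 h2 fun ha => hne ?_
    rw [hb, ha, map_zero]
    funext i j
    simp [wedge]

theorem IsLeafField.inducesDefinite_iff {V : R4 → R4} (h : IsLeafField V) :
    InducesDefinite (leafSpace V) ↔
      (∀ p ∈ H3, ∀ a, mink p a = 0 → mink (V p) a = 0 → a ≠ 0 →
        0 < mink (cross p (V p) a) (fderiv ℝ (rayExt V) p a)) ∨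
      (∀ p ∈ H3, ∀ a, mink p a = 0 → mink (V p) a = 0 → a ≠ 0 →
        mink (cross p (V p) a) (fderiv ℝ (rayExt V) p a) < 0) :=
  or_congr (h.forall_tangent_iff fun p v a b => 0 < mink (cross p v a) b)
    (h.forall_tangent_iff fun p v a b => mink (cross p v a) b < 0)

theorem IsLeafField.isSemidefinite_iff {V : R4 → R4} (h : IsLeafField V) :
    IsSemidefinite (leafSpace V) ↔
      ∀ p ∈ H3, ∀ a, mink p a = 0 → mink (V p) a = 0 → a ≠ 0 →
        mink (cross p (V p) a) (fderiv ℝ (rayExt V) p a) = 0 →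
        0 < mink a a - mink (fderiv ℝ (rayExt V) p a) (fderiv ℝ (rayExt V) p a) :=
  h.forall_tangent_iff fun p v a b => mink (cross p v a) b = 0 → 0 < mink a a - mink b b

/-! ### Eigenvectors and definiteness -/

theorem IsLeafField.exists_eigenvalue {V : R4 → R4} (h : IsLeafField V) {p a : R4} (hp : p ∈ H3)
    (hpa : mink p a = 0) (hva : mink (V p) a = 0) (ha : a ≠ 0)
    (h0 : mink (cross p (V p) a) (fderiv ℝ (rayExt V) p a) = 0) :
    ∃ k : ℝ, fderiv ℝ (rayExt V) p a = k • a :=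
  exists_smul_of_cross_eq_zero (u := h.vec hp) hpa hva
    (by
      change mink p _ = 0
      rw [h.mink_base_fderiv hp, hva, neg_zero])
    (h.mink_fderiv hp a) ha h0

/-- Since `∇_V V = 0` and `∇V` preserves the normal plane, an eigenvector outside `ℝ V` has a
normal component that is an eigenvector, and these are the null directions of
`a ↦ ⟨V × a, ∇_a V⟩`. -/
theorem IsLeafField.isNondegenerate_iff {V : R4 → R4} (h : IsLeafField V) :
    IsNondegenerate V ↔ ∀ p ∈ H3, ∀ a, mink p a = 0 → mink (V p) a = 0 → a ≠ 0 →
      mink (cross p (V p) a) (fderiv ℝ (rayExt V) p a) ≠ 0 := by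
  constructor
  · intro H p hp a hpa hva ha h0
    obtain ⟨k, hk⟩ := h.exists_eigenvalue hp hpa hva ha h0
    obtain ⟨c, rfl⟩ := H p hp a hpa ha k (by rw [h.covDeriv_eq hp hva, hk])
    rw [mink_smul_right, h.unit p hp, mul_one] at hva
    exact ha (by rw [hva, zero_smul])
  · intro H p hp u hpu hu k hk
    refine ⟨mink (V p) u, sub_eq_zero.1 ?_⟩
    set l := mink (V p) u with hl
    set a := u - l • V p with ha
    by_contra ha0
    have hpa : mink p a = 0 := by
      rw [ha, mink_sub_right, mink_smul_right, hpu, h.tangent p hp]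
      ring
    have hva : mink (V p) a = 0 := by
      rw [ha, mink_sub_right, mink_smul_right, h.unit p hp]
      ring
    have hu' : u = a + l • V p := by rw [ha, sub_add_cancel]
    have hD : fderiv ℝ (rayExt V) p a = k • u := by
      rw [← hk]
      change _ = tproj p (fderiv ℝ (rayExt V) p u)
      rw [tproj, h.mink_base_fderiv hp, ← hl]
      conv_rhs => rw [hu', map_add, map_smul, h.fderiv_self hp]
      module
    have hkl : k * l = 0 := by
      have := h.mink_fderiv hp a
      rwa [hD, mink_smul_right] at this
    refine H p hp a hpa hva ha0 ?_
    rw [hD, hu', smul_add, smul_smul, hkl, zero_smul, add_zero, mink_cross_smul_self]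

/-- A quadratic form that vanishes only at `0` has constant sign. -/
theorem cross_pos_of_pos {V : R4 → R4} {p : R4}
    (H : ∀ a, mink p a = 0 → mink (V p) a = 0 → a ≠ 0 →
      mink (cross p (V p) a) (fderiv ℝ (rayExt V) p a) ≠ 0) {a b : R4}
    (hpa : mink p a = 0) (hva : mink (V p) a = 0) (hpb : mink p b = 0) (hvb : mink (V p) b = 0)
    (hb : b ≠ 0) (ha : 0 < mink (cross p (V p) a) (fderiv ℝ (rayExt V) p a)) :
    0 < mink (cross p (V p) b) (fderiv ℝ (rayExt V) p b) := by
  by_contra! hn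
  have hn' := lt_of_le_of_ne hn (H b hpb hvb hb)
  set D := fderiv ℝ (rayExt V) p
  set B := mink (cross p (V p) a) (D b) + mink (cross p (V p) b) (D a) with hB
  have hexp : ∀ s : ℝ, mink (cross p (V p) (a + s • b)) (D (a + s • b))
      = mink (cross p (V p) b) (D b) * (s * s) + B * s + mink (cross p (V p) a) (D a) := by
    intro s
    rw [map_add, map_smul, mink_cross_add_left, mink_cross_smul_left, mink_add_right,
      mink_add_right, mink_smul_right, mink_smul_right, hB]
    ring
  obtain ⟨s, hs⟩ := exists_quadratic_eq_zero (a := mink (cross p (V p) b) (D b)) (b := B)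
    (c := mink (cross p (V p) a) (D a)) hn'.ne
    ⟨Real.sqrt (discrim _ _ _), (Real.mul_self_sqrt (by
      rw [discrim]
      nlinarith [sq_nonneg B, mul_pos ha (neg_pos.2 hn')])).symm⟩
  have h0 : a + s • b = 0 := by
    by_contra hne
    refine H (a + s • b) ?_ ?_ hne ((hexp s).trans hs)
    · rw [mink_add_right, mink_smul_right, hpa, hpb]
      ring
    · rw [mink_add_right, mink_smul_right, hva, hvb]
      ring
  rw [eq_neg_of_add_eq_zero_left h0, ← neg_smul, mink_cross_smul_left, map_smul,
    mink_smul_right] at ha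
  nlinarith [sq_nonneg s]

theorem exists_normal_ne_zero (p v : R4) : ∃ a, mink p a = 0 ∧ mink v a = 0 ∧ a ≠ 0 := by
  let f : R4 →ₗ[ℝ] ℝ × ℝ :=
    { toFun := fun a => (mink p a, mink v a)
      map_add' := fun a b => by simp [mink_add_right]
      map_smul' := fun k a => by simp [mink_smul_right] }
  have hf : LinearMap.ker f ≠ ⊥ := LinearMap.ker_ne_bot_of_finrank_lt (by simp)
  obtain ⟨a, ha, ha0⟩ := (Submodule.ne_bot_iff _).1 hf
  have := Prod.ext_iff.1 (LinearMap.mem_ker.1 ha)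
  exact ⟨a, this.1, this.2, ha0⟩

theorem isPreconnected_H3 : IsPreconnected H3 := by
  let f : (Fin 3 → ℝ) → R4 := fun x =>
    ![Real.sqrt (1 + (x 0 ^ 2 + x 1 ^ 2 + x 2 ^ 2)), x 0, x 1, x 2]
  have hf : Continuous f := by
    refine continuous_pi fun i => ?_
    fin_cases i <;> simp [f] <;> fun_prop
  have he : H3 = Set.range f := by
    ext p
    constructor
    · rintro ⟨hp, hp0⟩
      refine ⟨![p 1, p 2, p 3], ?_⟩
      have h0 : Real.sqrt (1 + (p 1 ^ 2 + p 2 ^ 2 + p 3 ^ 2)) = p 0 := by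
        simp only [mink] at hp
        rw [show 1 + (p 1 ^ 2 + p 2 ^ 2 + p 3 ^ 2) = p 0 ^ 2 by linarith, Real.sqrt_sq hp0.le]
      funext i
      fin_cases i <;> simp [f, h0]
    · rintro ⟨x, rfl⟩
      have h1 : 0 < 1 + (x 0 ^ 2 + x 1 ^ 2 + x 2 ^ 2) := by positivity
      have h2 := Real.mul_self_sqrt h1.le
      refine ⟨?_, by simpa [f] using h1⟩
      simp only [mink, f, Matrix.cons_val]
      linarith
  rw [he]
  exact isPreconnected_range hf

/-- The form `⟨V × a, ∇_a V⟩` on the normal planes, evaluated at the normal projections of a fixed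
vector of Minkowski space, is continuous along `ℍ³`. -/
theorem IsLeafField.continuous_cross {V : R4 → R4} (h : IsLeafField V) (a : R4) :
    Continuous fun p : H3 =>
      mink (cross p (V p) (a + mink p.1 a • p.1 - mink (V p) a • V p))
        (fderiv ℝ (rayExt V) p (a + mink p.1 a • p.1 - mink (V p) a • V p)) := by
  have hsub : ∀ p : H3, p.1 ∈ futureCone := fun p => H3_subset_futureCone p.2
  have hV : Continuous fun p : H3 => V p :=
    (h.smooth.continuousOn.comp_continuous continuous_subtype_val hsub).congr
      fun p => rayExt_eq p.2
  have hD : Continuous fun p : H3 => fderiv ℝ (rayExt V) p :=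
    (h.smooth.continuousOn_fderiv_of_isOpen isOpen_futureCone (by simp)).comp_continuous
      continuous_subtype_val hsub
  have hp : Continuous fun p : H3 => p.1 := continuous_subtype_val
  have ha : Continuous fun p : H3 => a + mink p.1 a • p.1 - mink (V p) a • V p :=
    (continuous_const.add ((hp.mink continuous_const).smul hp)).sub
      ((hV.mink continuous_const).smul hV)
  simp only [mink_cross]
  refine Continuous.matrix_det (continuous_pi fun i => ?_)
  fin_cases i
  · exact hp
  · exact hV
  · exact ha
  · exact hD.clm_apply ha

/-- If `⟨V × a, ∇_a V⟩` has no null directions, then its sign on the normal planes is the same at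
all points, because `ℍ³` is connected. -/
theorem IsLeafField.cross_definite {V : R4 → R4} (h : IsLeafField V)
    (H : ∀ p ∈ H3, ∀ a, mink p a = 0 → mink (V p) a = 0 → a ≠ 0 →
      mink (cross p (V p) a) (fderiv ℝ (rayExt V) p a) ≠ 0) :
    (∀ p ∈ H3, ∀ a, mink p a = 0 → mink (V p) a = 0 → a ≠ 0 →
      0 < mink (cross p (V p) a) (fderiv ℝ (rayExt V) p a)) ∨
    (∀ p ∈ H3, ∀ a, mink p a = 0 → mink (V p) a = 0 → a ≠ 0 →
      mink (cross p (V p) a) (fderiv ℝ (rayExt V) p a) < 0) := by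
  have : PreconnectedSpace H3 := isPreconnected_iff_preconnectedSpace.1 isPreconnected_H3
  let S : Set H3 := {p | ∀ a, mink p.1 a = 0 → mink (V p) a = 0 → a ≠ 0 →
      0 < mink (cross p (V p) a) (fderiv ℝ (rayExt V) p a)}
  have hproj : ∀ (p : H3) (a : R4), mink p.1 (a + mink p.1 a • p.1 - mink (V p) a • V p) = 0 ∧
      mink (V p) (a + mink p.1 a • p.1 - mink (V p) a • V p) = 0 := by
    intro p a
    have h1 := h.tangent p p.2
    constructor <;>
      simp only [mink_sub_right, mink_add_right, mink_smul_right, p.2.1, h1, h.unit p p.2,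
        mink_comm (V p) p.1] <;> ring
  have hfix : ∀ (p : H3) (a : R4), mink p.1 a = 0 → mink (V p) a = 0 →
      a + mink p.1 a • p.1 - mink (V p) a • V p = a := by
    intro p a h1 h2
    rw [h1, h2]
    simp
  -- Membership in `S` may be tested on a single normal vector.
  have hS : ∀ (p : H3) (a : R4), mink p.1 a = 0 → mink (V p) a = 0 →
      0 < mink (cross p (V p) a) (fderiv ℝ (rayExt V) p a) → p ∈ S :=
    fun p a h1 h2 h3 b hb hb' hb0 => cross_pos_of_pos (H p p.2) h1 h2 hb hb' hb0 h3
  have hopen : IsOpen S := by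
    rw [isOpen_iff_mem_nhds]
    intro p hp
    obtain ⟨a, h1, h2, h3⟩ := exists_normal_ne_zero p (V p)
    have h4 := hp a h1 h2 h3
    rw [← hfix p a h1 h2] at h4
    filter_upwards [(h.continuous_cross a).continuousAt.eventually (lt_mem_nhds h4)] with q hq
    exact hS q _ (hproj q a).1 (hproj q a).2 hq
  have hclosed : IsClosed S := by
    rw [← isOpen_compl_iff, isOpen_iff_mem_nhds]
    intro p hp
    obtain ⟨a, h1, h2, h3⟩ := exists_normal_ne_zero p (V p)
    have h4 : mink (cross p (V p) a) (fderiv ℝ (rayExt V) p a) < 0 :=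
      lt_of_le_of_ne (not_lt.1 fun hc => hp (hS p a h1 h2 hc)) (H p p.2 a h1 h2 h3)
    rw [← hfix p a h1 h2] at h4
    filter_upwards [(h.continuous_cross a).continuousAt.eventually (gt_mem_nhds h4)] with q hq hqS
    refine lt_asymm hq (hqS _ (hproj q a).1 (hproj q a).2 fun h0 => ?_)
    rw [h0, map_zero, mink_zero_right] at hq
    exact lt_irrefl _ hq
  rcases isClopen_iff.1 ⟨hclosed, hopen⟩ with hE | hU
  · refine Or.inr fun p hp a h1 h2 h3 => lt_of_le_of_ne (not_lt.1 fun hc => ?_) (H p hp a h1 h2 h3)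
    have : (⟨p, hp⟩ : H3) ∈ S := hS ⟨p, hp⟩ a h1 h2 hc
    rw [hE] at this
    exact this
  · refine Or.inl fun p hp => ?_
    have : (⟨p, hp⟩ : H3) ∈ S := by rw [hU]; trivial
    exact this

theorem IsLeafField.isNondegenerate_iff_inducesDefinite {V : R4 → R4} (h : IsLeafField V) :
    IsNondegenerate V ↔ InducesDefinite (leafSpace V) := by
  rw [h.isNondegenerate_iff, h.inducesDefinite_iff]
  refine ⟨h.cross_definite, ?_⟩
  rintro (H | H) p hp a h1 h2 h3
  · exact (H p hp a h1 h2 h3).ne'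
  · exact (H p hp a h1 h2 h3).ne

/-! ### The forward Gauss map -/

theorem boundaryEmb_gaussForward (u : UnitTangent) :
    boundaryEmb (gaussForward u.line) = asymDir u := rfl

theorem asymDir_add_origin (u : UnitTangent) :
    asymDir u + origin = (u.base 0 + u.dir 0)⁻¹ • (u.base + u.dir) := by
  rw [asymDir, sub_add_cancel]

theorem boundaryEmb_injective : Function.Injective boundaryEmb := by
  intro z w hzw
  obtain ⟨u, rfl⟩ := Quotient.exists_rep z
  obtain ⟨v, rfl⟩ := Quotient.exists_rep w
  exact Quotient.sound ((asymptotic_iff u v).2 hzw)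

theorem mink_boundaryEmb_add_origin (z : Boundary) :
    mink (boundaryEmb z + origin) (boundaryEmb z + origin) = 0 := by
  obtain ⟨u, rfl⟩ := Quotient.exists_rep z
  change mink (asymDir u + origin) (asymDir u + origin) = 0
  rw [asymDir_add_origin, mink_smul_left, mink_smul_right, mink_nullSum, mul_zero, mul_zero]

theorem boundaryEmb_add_origin_zero (z : Boundary) : (boundaryEmb z + origin) 0 = 1 := by
  obtain ⟨u, rfl⟩ := Quotient.exists_rep z
  change (asymDir u + origin) 0 = 1
  rw [asymDir_add_origin]
  exact inv_mul_cancel₀ (nullSum_pos u).ne'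

theorem smoothOn_gaussForward (S : Set OrientedGeodesic) :
    SmoothOn plucker boundaryEmb S gaussForward := by
  have hpos : ∀ ℓ, 0 < forwardNull (plucker ℓ) 0 := by
    intro ℓ
    obtain ⟨u, rfl⟩ := Quotient.exists_rep ℓ
    change 0 < forwardNull (plucker u.line) 0
    rw [forwardNull_plucker]
    exact mul_pos (nullDiff_pos u) (nullSum_pos u)
  have hc : ContDiff ℝ ∞ fun B => forwardNull B 0 := contDiff_pi.1 contDiff_forwardNull 0
  intro ℓ _
  refine ⟨{B | forwardNull B 0 ≠ 0}, fun B => (forwardNull B 0)⁻¹ • forwardNull B - origin,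
    isOpen_ne.preimage hc.continuous, (hpos ℓ).ne', ?_, ?_⟩
  · intro B hB
    exact (((hc.contDiffAt.inv hB).smul contDiff_forwardNull.contDiffAt).sub
      contDiffAt_const).contDiffWithinAt
  · intro y _ _
    obtain ⟨u, rfl⟩ := Quotient.exists_rep y
    change asymDir u = (forwardNull (plucker u.line) 0)⁻¹ • forwardNull (plucker u.line) - origin
    have h1 := (nullDiff_pos u).ne'
    rw [forwardNull_plucker, asymDir, Pi.smul_apply, Pi.add_apply, smul_eq_mul, mul_inv, smul_smul,
      mul_right_comm, inv_mul_cancel₀ h1, one_mul]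

/-- A local diffeomorphism is infinitesimally injective; the differential of the forward Gauss map
on the tangent vector `(a, ∇_a V)` is, up to normalization, `a + ∇_a V`. -/
theorem IsLeafField.injective_of_gaussForward {V : R4 → R4} (h : IsLeafField V)
    (H : IsLocalDiffeoOn plucker boundaryEmb (leafSpace V) gaussForward) {p a : R4} (hp : p ∈ H3)
    (hpa : mink p a = 0) (hva : mink (V p) a = 0) (h0 : a + fderiv ℝ (rayExt V) p a = 0) :
    a = 0 := by
  have hm := fun t => tangentCurve_mem hp hpa t
  obtain ⟨U, W, g, hU, hW, hxU, hf, hg, -, hgs⟩ := H _ (h.vec_line_mem (hm 0))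
  obtain ⟨U', G, hU', hxU', hG, hGe⟩ := hgs (gaussForward (h.vec (hm 0)).line)
    (hf _ (h.vec_line_mem (hm 0)) hxU).1
  have hc := hasDerivAt_tangentCurve p a
  have hD := hasDerivAt_rayExt_comp h hc (tangentCurve_zero p a) hp
  have hpl : HasDerivAt (fun t => plucker (h.vec (hm t)).line)
      (wedge a (V p) + wedge p (fderiv ℝ (rayExt V) p a)) 0 := by
    have h1 := hc.wedge hD
    rw [tangentCurve_zero, rayExt_eq hp] at h1
    exact h1.congr_of_eventuallyEq (.of_forall fun t => h.plucker_vec (hm t))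
  have hem : HasDerivAt (fun t => boundaryEmb (gaussForward (h.vec (hm t)).line)) 0 0 := by
    have h1 := hc.add hD
    rw [h0] at h1
    have h2 := hasDerivAt_pi.1 h1 0
    have hne : (tangentCurve p a + fun t => rayExt V (tangentCurve p a t)) 0 0 ≠ 0 := by
      have : p 0 + V p 0 ≠ 0 := (nullSum_pos (h.vec hp)).ne'
      simpa [rayExt_eq hp] using this
    have h3 := ((h2.fun_inv hne).fun_smul h1).sub_const origin
    refine (h3.congr_of_eventuallyEq (.of_forall fun t => ?_)).congr_deriv (by simp)
    change ((tangentCurve p a t) 0 + (V (tangentCurve p a t)) 0)⁻¹ • (tangentCurve p a t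
      + V (tangentCurve p a t)) - origin = _
    rw [← rayExt_eq (V := V) (hm t)]
    rfl
  have hGd : DifferentiableAt ℝ G (boundaryEmb (gaussForward (h.vec (hm 0)).line)) :=
    (hG.contDiffAt (hU'.mem_nhds hxU')).differentiableAt (by simp)
  have hcomp := hGd.hasFDerivAt.comp_hasDerivAt (0 : ℝ) hem
  rw [map_zero] at hcomp
  have hz : wedge a (V p) + wedge p (fderiv ℝ (rayExt V) p a) = 0 := by
    refine hpl.unique (hcomp.congr_of_eventuallyEq ?_)
    filter_upwards [hpl.continuousAt (hU.mem_nhds hxU), hem.continuousAt (hU'.mem_nhds hxU')]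
      with t ht ht'
    obtain ⟨h1, h2⟩ := hf _ (h.vec_line_mem (hm t)) ht
    have h3 := hGe _ h1 ht'
    rw [h2] at h3
    exact h3
  have e := congrArg (contract · (V p)) hz
  simp only [contract_add, contract_wedge, h.tangent p hp, h.unit p hp, mink_comm _ (V p), hva,
    h.mink_fderiv hp a] at e
  simpa [contract, funext_iff] using e

/-- The vector `x + V x`, for the ray extension of `V`, is null exactly when `x` lies on `ℍ³`. -/
theorem IsLeafField.mink_add_rayExt {V : R4 → R4} (h : IsLeafField V) {x : R4}
    (hx : x ∈ futureCone) : mink (x + rayExt V x) (x + rayExt V x) = mink x x + 1 := by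
  have h1 : mink (rayExt V x) (rayExt V x) = 1 := h.unit _ (radialProj_mem hx)
  simp only [mink_add_left, mink_add_right, mink_comm (rayExt V x) x, mink_rayExt h.tangent hx, h1]
  ring

/-- If `-1` is not an eigenvalue of `∇V` at `p`, then `x ↦ x + V x` is a diffeomorphism of a
neighbourhood of `p` in Minkowski space onto an open set. -/
theorem IsLeafField.exists_localInverse {V : R4 → R4} (h : IsLeafField V) {p : R4} (hp : p ∈ H3)
    (H : ∀ a, mink p a = 0 → mink (V p) a = 0 → a + fderiv ℝ (rayExt V) p a = 0 → a = 0) :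
    ∃ e : OpenPartialHomeomorph R4 R4, p ∈ e.source ∧ e.source ⊆ futureCone ∧
      (∀ x, e x = x + rayExt V x) ∧ ContDiffOn ℝ ∞ e.symm e.target := by
  set F : R4 → R4 := fun x => x + rayExt V x with hF
  have hFs : ContDiffOn ℝ ∞ F futureCone := contDiffOn_id.add h.smooth
  have hFat : ∀ x ∈ futureCone, ContDiffAt ℝ ∞ F x := fun x hx =>
    hFs.contDiffAt (isOpen_futureCone.mem_nhds hx)
  have hpc := H3_subset_futureCone hp
  have hFd : HasFDerivAt F (ContinuousLinearMap.id ℝ R4 + fderiv ℝ (rayExt V) p) p :=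
    (hasFDerivAt_id p).add
      ((h.smooth.contDiffAt (futureCone_mem_nhds hp)).differentiableAt (by simp)).hasFDerivAt
  have hinj : Function.Injective (ContinuousLinearMap.id ℝ R4 + fderiv ℝ (rayExt V) p) := by
    rw [injective_iff_map_eq_zero]
    intro y hy
    have hy' : y + fderiv ℝ (rayExt V) p y = 0 := hy
    have e1 := congrArg (mink (V p)) hy'
    rw [mink_add_right, h.mink_fderiv hp, mink_zero_right, add_zero] at e1
    have e2 := congrArg (mink p) hy'
    rw [mink_add_right, h.mink_base_fderiv hp, e1, mink_zero_right, neg_zero, add_zero] at e2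
    exact H y e2 e1 hy'
  let E : R4 ≃L[ℝ] R4 := (LinearEquiv.ofInjectiveEndo
    ((ContinuousLinearMap.id ℝ R4 + fderiv ℝ (rayExt V) p : R4 →L[ℝ] R4) : R4 →ₗ[ℝ] R4)
    hinj).toContinuousLinearEquiv
  have hE : HasFDerivAt F (E : R4 →L[ℝ] R4) p := hFd
  have hO : IsOpen (futureCone ∩ fderiv ℝ F ⁻¹'
      Set.range ((↑) : (R4 ≃L[ℝ] R4) → R4 →L[ℝ] R4)) :=
    (hFs.continuousOn_fderiv_of_isOpen isOpen_futureCone (by simp)).isOpen_inter_preimage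
      isOpen_futureCone ContinuousLinearEquiv.isOpen
  refine ⟨((hFat p hpc).toOpenPartialHomeomorph F hE (by simp)).restrOpen _ hO,
    ⟨(hFat p hpc).mem_toOpenPartialHomeomorph_source hE (by simp), hpc, ⟨E, hE.fderiv.symm⟩⟩,
    fun x hx => hx.2.1, fun x => rfl, ?_⟩
  intro y hy
  have hs := OpenPartialHomeomorph.map_target _ hy
  obtain ⟨E', hE'⟩ := hs.2.2
  have hd := ((hFat _ hs.2.1).differentiableAt (by simp)).hasFDerivAt
  rw [← hE'] at hd
  exact (OpenPartialHomeomorph.contDiffAt_symm _ hy hd (hFat _ hs.2.1)).contDiffWithinAt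

/-- The inverse function theorem for the forward Gauss map.  Instead of charts of the space of
leaves and of the sphere at infinity, the local inverse of `x ↦ x + V x` on Minkowski space is
used: it maps a point at infinity, represented by a null vector, to a point of the leaf that ends
there. -/
theorem IsLeafField.gaussForward_of_injective {V : R4 → R4} (h : IsLeafField V)
    (H : ∀ p ∈ H3, ∀ a, mink p a = 0 → mink (V p) a = 0 → a + fderiv ℝ (rayExt V) p a = 0 →
      a = 0) :
    IsLocalDiffeoOn plucker boundaryEmb (leafSpace V) gaussForward := by
  classical
  rintro ℓ ⟨u, hu, rfl⟩
  obtain ⟨e, hpe, hec, heF, hes⟩ := h.exists_localInverse u.base_mem (H _ u.base_mem)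
  set c := u.base 0 + u.dir 0 with hc
  have hc0 : 0 < c := nullSum_pos u
  have hsc : ContDiff ℝ ∞ fun w : R4 => c • (w + origin) :=
    (contDiff_id.add contDiff_const).const_smul c
  -- The point of `ℍ³` near `u.base` on the leaf that ends at a given point at infinity.
  have hH : ∀ z : Boundary, c • (boundaryEmb z + origin) ∈ e.target →
      ∃ hx : e.symm (c • (boundaryEmb z + origin)) ∈ H3,
        (h.vec hx).base + (h.vec hx).dir = c • (boundaryEmb z + origin) := by
    intro z hz
    have hx := hec (e.map_target hz)
    have h1 := e.right_inv hz
    rw [heF] at h1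
    have h2 := h.mink_add_rayExt hx
    rw [h1, mink_smul_left, mink_smul_right, mink_boundaryEmb_add_origin] at h2
    have hx' : e.symm (c • (boundaryEmb z + origin)) ∈ H3 := ⟨by linarith, hx.2⟩
    refine ⟨hx', ?_⟩
    rw [rayExt_eq hx'] at h1
    exact h1
  let g : Boundary → OrientedGeodesic := fun z =>
    if hz : e.symm (c • (boundaryEmb z + origin)) ∈ H3 then (h.vec hz).line else u.line
  have hFoot : ContinuousOn (footPoint c) {B | axisSum B 0 ≠ 0} := fun B hB =>
    (contDiffAt_footPoint c hB).continuousAt.continuousWithinAt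
  have hne : IsOpen {B : Fin 4 → Fin 4 → ℝ | axisSum B 0 ≠ 0} :=
    isOpen_ne.preimage (contDiff_pi.1 contDiff_axisSum 0).continuous
  refine ⟨{B | axisSum B 0 ≠ 0} ∩ footPoint c ⁻¹' e.source,
    (fun w => c • (w + origin)) ⁻¹' e.target, g,
    hFoot.isOpen_inter_preimage hne e.open_source, e.open_target.preimage hsc.continuous,
    ⟨(axisSum_plucker_pos u).ne', ?_⟩, ?_, ?_, smoothOn_gaussForward _, ?_⟩
  · change footPoint c (plucker u.line) ∈ e.source
    rwa [footPoint_plucker]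
  · intro y hy hyU
    obtain ⟨w, rfl, hwc, hwf⟩ := exists_line_eq y hc0
    have hw := h.line_mem_iff.1 hy
    have hws : w.base ∈ e.source := by
      rw [hwf]
      exact hyU.2
    have hN : c • (boundaryEmb (gaussForward w.line) + origin) = e w.base := by
      rw [boundaryEmb_gaussForward, asymDir_add_origin, hwc, smul_smul,
        mul_inv_cancel₀ hc0.ne', one_smul, heF, rayExt_eq w.base_mem, hw]
    refine ⟨?_, ?_⟩
    · change c • (boundaryEmb (gaussForward w.line) + origin) ∈ e.target
      rw [hN]
      exact e.map_source hws
    · have hb : e.symm (c • (boundaryEmb (gaussForward w.line) + origin)) = w.base := by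
        rw [hN, e.left_inv hws]
      have hz : e.symm (c • (boundaryEmb (gaussForward w.line) + origin)) ∈ H3 := by
        rw [hb]
        exact w.base_mem
      simp only [g, dif_pos hz]
      exact congrArg UnitTangent.line (UnitTangent.ext hb ((congrArg V hb).trans hw.symm))
  · intro z hz
    obtain ⟨hx, hsum⟩ := hH z hz
    have hgz : g z = (h.vec hx).line := dif_pos hx
    have hsum0 : (h.vec hx).base 0 + (h.vec hx).dir 0 = c := by
      have := congrFun hsum 0
      rwa [Pi.smul_apply, boundaryEmb_add_origin_zero, smul_eq_mul, mul_one] at this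
    rw [hgz]
    refine ⟨h.vec_line_mem hx, ⟨(axisSum_plucker_pos _).ne', ?_⟩, boundaryEmb_injective ?_⟩
    · have hfoot := footPoint_plucker (h.vec hx)
      rw [hsum0] at hfoot
      change footPoint c (plucker (h.vec hx).line) ∈ e.source
      rw [hfoot]
      exact e.map_target hz
    · rw [boundaryEmb_gaussForward, asymDir, hsum0, hsum, smul_smul, inv_mul_cancel₀ hc0.ne',
        one_smul, add_sub_cancel_right]
  · intro z hz
    have hx : ContDiffOn ℝ ∞ (fun w => e.symm (c • (w + origin)))
        ((fun w => c • (w + origin)) ⁻¹' e.target) :=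
      hes.comp hsc.contDiffOn fun w hw => hw
    have hWx : ContDiffOn ℝ ∞ (fun w => rayExt V (e.symm (c • (w + origin))))
        ((fun w => c • (w + origin)) ⁻¹' e.target) :=
      h.smooth.comp hx fun w hw => hec (e.map_target hw)
    refine ⟨(fun w => c • (w + origin)) ⁻¹' e.target,
      fun w => wedge (e.symm (c • (w + origin))) (rayExt V (e.symm (c • (w + origin)))),
      e.open_target.preimage hsc.continuous, hz, ?_, ?_⟩
    · exact contDiffOn_pi.2 fun i => contDiffOn_pi.2 fun j =>
        ((contDiffOn_pi.1 hx i).mul (contDiffOn_pi.1 hWx j)).sub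
          ((contDiffOn_pi.1 hWx i).mul (contDiffOn_pi.1 hx j))
    · intro y hy _
      obtain ⟨hxy, -⟩ := hH y hy
      have hgy : g y = (h.vec hxy).line := dif_pos hxy
      rw [hgy, h.plucker_vec hxy]

theorem IsLeafField.gaussForward_iff {V : R4 → R4} (h : IsLeafField V) :
    IsLocalDiffeoOn plucker boundaryEmb (leafSpace V) gaussForward ↔
      ∀ p ∈ H3, ∀ a, mink p a = 0 → mink (V p) a = 0 → a + fderiv ℝ (rayExt V) p a = 0 → a = 0 :=
  ⟨fun H _ hp _ h1 h2 h3 => h.injective_of_gaussForward H hp h1 h2 h3, h.gaussForward_of_injective⟩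

/-! ### Reversal of orientations and the backward Gauss map -/

/-- The involution of `𝓛` that reverses the orientation of a geodesic. -/
def OrientedGeodesic.reverse : OrientedGeodesic → OrientedGeodesic :=
  Quotient.map UnitTangent.reverse (by
    rintro u w ⟨t, rfl⟩
    exact ⟨-t, reverse_flow t u⟩)

theorem UnitTangent.reverse_reverse (u : UnitTangent) : u.reverse.reverse = u :=
  UnitTangent.ext rfl (neg_neg u.dir)

theorem OrientedGeodesic.reverse_reverse (ℓ : OrientedGeodesic) : ℓ.reverse.reverse = ℓ := by
  obtain ⟨u, rfl⟩ := Quotient.exists_rep ℓ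
  exact congrArg UnitTangent.line u.reverse_reverse

theorem plucker_reverse (ℓ : OrientedGeodesic) : plucker ℓ.reverse = -plucker ℓ := by
  obtain ⟨u, rfl⟩ := Quotient.exists_rep ℓ
  change wedge u.base (-u.dir) = -wedge u.base u.dir
  funext i j
  simp only [wedge, Pi.neg_apply]
  ring

theorem gaussBackward_eq (ℓ : OrientedGeodesic) : gaussBackward ℓ = gaussForward ℓ.reverse := by
  obtain ⟨u, rfl⟩ := Quotient.exists_rep ℓ
  rfl

/-- Local diffeomorphisms are preserved by an involution of the source that acts as `-1` on the
ambient vector space. -/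
theorem IsLocalDiffeoOn.comp_involution {X Y E F : Type*} [NormedAddCommGroup E] [NormedSpace ℝ E]
    [NormedAddCommGroup F] [NormedSpace ℝ F] {eX : X → E} {eY : Y → F} {M : Set X} {f : X → Y}
    (h : IsLocalDiffeoOn eX eY M f) {r : X → X} (hr : ∀ x, r (r x) = x)
    (he : ∀ x, eX (r x) = -eX x) : IsLocalDiffeoOn eX eY (r ⁻¹' M) (fun x => f (r x)) := by
  intro x hx
  obtain ⟨U, W, g, hU, hW, hxU, hf, hg, hfs, hgs⟩ := h (r x) hx
  refine ⟨-U, W, fun z => r (g z), hU.neg, hW, by simpa [he] using hxU, ?_, ?_, ?_, ?_⟩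
  · intro y hy hyU
    obtain ⟨h1, h2⟩ := hf (r y) hy (by simpa [he] using hyU)
    exact ⟨h1, (congrArg r h2).trans (hr y)⟩
  · intro z hz
    obtain ⟨h1, h2, h3⟩ := hg z hz
    refine ⟨?_, by simpa [he] using h2, (congrArg f (hr (g z))).trans h3⟩
    rw [Set.mem_preimage, hr]
    exact h1
  · rintro y ⟨hy, hyU⟩
    obtain ⟨U', G, h1, h2, h3, h4⟩ := hfs (r y) ⟨hy, by simpa [he] using hyU⟩
    refine ⟨-U', fun v => G (-v), h1.neg, by simpa [he] using h2, ?_, ?_⟩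
    · exact h3.comp contDiff_neg.contDiffOn fun v hv => hv
    · rintro w ⟨hw, hwU⟩ hw'
      rw [h4 (r w) ⟨hw, by simpa [he] using hwU⟩ (by simpa [he] using hw'), he]
  · intro z hz
    obtain ⟨U', G, h1, h2, h3, h4⟩ := hgs z hz
    exact ⟨U', fun v => -G v, h1, h2, h3.neg, fun w hw hw' => by rw [he, h4 w hw hw']⟩

theorem rayExt_neg (V : R4 → R4) : rayExt (-V) = -rayExt V := rfl

theorem IsLeafField.neg {V : R4 → R4} (h : IsLeafField V) : IsLeafField (-V) where
  smooth := h.smooth.neg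
  tangent p hp := by rw [Pi.neg_apply, mink_neg_right, h.tangent p hp, neg_zero]
  unit p hp := by rw [Pi.neg_apply, mink_neg_right, mink_neg_left, neg_neg, h.unit p hp]
  flow u hu t := by
    have h1 := h.flow u.reverse (by simp [UnitTangent.reverse, hu]) (-t)
    have h2 : u.reverse.geod (-t) = u.geod t := by
      simp [UnitTangent.reverse, UnitTangent.geod]
    have h3 : u.reverse.vel (-t) = -u.vel t := by
      simp [UnitTangent.reverse, UnitTangent.vel, add_comm]
    rw [h2, h3] at h1
    rw [Pi.neg_apply, ← h1, neg_neg]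

theorem IsLeafField.leafSpace_neg {V : R4 → R4} (h : IsLeafField V) :
    leafSpace (-V) = OrientedGeodesic.reverse ⁻¹' leafSpace V := by
  ext ℓ
  obtain ⟨u, rfl⟩ := Quotient.exists_rep ℓ
  change u.line ∈ leafSpace (-V) ↔ u.reverse.line ∈ leafSpace V
  rw [h.neg.line_mem_iff, h.line_mem_iff]
  exact neg_eq_iff_eq_neg.symm

theorem IsLeafField.gaussBackward_iff {V : R4 → R4} (h : IsLeafField V) :
    IsLocalDiffeoOn plucker boundaryEmb (leafSpace V) gaussBackward ↔
      ∀ p ∈ H3, ∀ a, mink p a = 0 → mink (V p) a = 0 → a - fderiv ℝ (rayExt V) p a = 0 → a = 0 := by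
  have h1 : IsLocalDiffeoOn plucker boundaryEmb (leafSpace V) gaussBackward ↔
      IsLocalDiffeoOn plucker boundaryEmb (leafSpace (-V)) gaussForward := by
    have hb : gaussBackward = fun ℓ => gaussForward ℓ.reverse := funext gaussBackward_eq
    constructor
    · intro H
      have := H.comp_involution OrientedGeodesic.reverse_reverse plucker_reverse
      rw [← h.leafSpace_neg] at this
      simpa only [hb, OrientedGeodesic.reverse_reverse] using this
    · intro H
      have := H.comp_involution OrientedGeodesic.reverse_reverse plucker_reverse
      rwa [← h.neg.leafSpace_neg, neg_neg, ← hb] at this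
  rw [h1, h.neg.gaussForward_iff]
  simp only [rayExt_neg, Pi.neg_apply, mink_neg_left, neg_eq_zero, fderiv_neg,
    neg_apply, ← sub_eq_add_neg]

/-- The null directions of `g_×` are the eigenvectors of `∇V` on the normal planes, with
eigenvalues in `[-1, 1]`; on them `g_K` is positive unless the eigenvalue is `1` or `-1`, and these
are the kernels of the differentials of the Gauss maps. -/
theorem IsLeafField.isSemiNondegenerate_iff {V : R4 → R4} (h : IsLeafField V) :
    IsSemiNondegenerate V ↔ IsSemidefinite (leafSpace V) := by
  rw [IsSemiNondegenerate, h.gaussForward_iff, h.gaussBackward_iff, h.isSemidefinite_iff]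
  constructor
  · rintro ⟨hf, hb⟩ p hp a hpa hva ha h0
    obtain ⟨k, hk⟩ := h.exists_eigenvalue hp hpa hva ha h0
    have hle := h.sq_eigenvalue_le_one hp hpa ha hk
    have h1 : k ≠ 1 := by
      rintro rfl
      exact ha (hb p hp a hpa hva (by rw [hk, one_smul, sub_self]))
    have h2 : k ≠ -1 := by
      rintro rfl
      exact ha (hf p hp a hpa hva (by rw [hk, neg_one_smul, add_neg_cancel]))
    have hlt : k ^ 2 < 1 := lt_of_le_of_ne hle fun hc => by
      rcases sq_eq_one_iff.1 hc with h | h <;> contradiction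
    rw [hk, mink_smul_left, mink_smul_right]
    nlinarith [mink_self_pos hp hpa ha]
  · intro H
    constructor <;> intro p hp a hpa hva h0 <;> by_contra ha
    · have hk : fderiv ℝ (rayExt V) p a = (-1 : ℝ) • a := by
        rw [neg_one_smul, eq_neg_of_add_eq_zero_right h0]
      have := H p hp a hpa hva ha (by rw [hk, mink_cross_smul_self])
      rw [hk, mink_smul_left, mink_smul_right] at this
      linarith
    · have hk : fderiv ℝ (rayExt V) p a = (1 : ℝ) • a := by
        rw [one_smul, ← sub_eq_zero.1 h0]
      have := H p hp a hpa hva ha (by rw [hk, mink_cross_smul_self])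
      rw [hk, mink_smul_left, mink_smul_right] at this
      linarith

end HypFoliation

theorem mainTheorem2 (V : HypFoliation.R4 → HypFoliation.R4)
    (hV : HypFoliation.IsGeodesicFoliation V) :
    (HypFoliation.IsSemiNondegenerate V ↔
      HypFoliation.IsSemidefinite (HypFoliation.leafSpace V)) ∧
    (HypFoliation.IsNondegenerate V ↔
      HypFoliation.InducesDefinite (HypFoliation.leafSpace V)) :=
  ⟨hV.isLeafField.isSemiNondegenerate_iff, hV.isLeafField.isNondegenerate_iff_inducesDefinite⟩
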